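/- Let $p_1,p_2\ge 3$ be integers, and let $\{a_{q,r}\},\{c_{q,r}\}$ (real) and $\{\alpha_{q,r}\},\{b_{q,r}\}$ (complex), $q,r\in\mathbb Z$, be $(p_1,p_2)$-periodic double sequences, that is, $w_{q+k_1p_1,\,r+k_2p_2}=w_{q,r}$ for all $q,r,k_1,k_2\in\mathbb Z$. For a bounded real sequence $\{d_r\}$ and a bounded complex sequence $\{w_r\}$ let $J(\{d_r\},\{w_r\})$ be the Hermitian Jacobi operator on $\ell^2(\mathbb Z)$ (complex sequences), $$(J(\{d_r\},\{w_r\})x)_r=\overline{w_{r-1}}\,x_{r-1}+d_r x_r+w_r x_{r+1},\qquad r\in\mathbb Z .$$ Put $A_q=J(\{a_{q,r}\}_r,\{\alpha_{q,r}\}_r)$, $B_q=J(\{c_{q,r}\}_r,\{b_{q,r}\}_r)$, and let $J$ be the (bounded, self-adjoint) Jacobi-block-Jacobi operator on $\ell^2(\mathbb Z,\ell^2(\mathbb Z))$, $$(Ju)_q=A_{q-1}u_{q-1}+B_qu_q+A_qu_{q+1},\qquad q\in\mathbb Z .$$ For $(m,n)\in\mathbb Z^2$ put $$R_{m,n}=4\sum_{j=1}^{p_1}\bigl(|b_{j,n}|+2|\alpha_{j,n}|\bigr)+4\sum_{k=1}^{p_2}\bigl(|a_{m,k}|+2|\alpha_{m,k}|\bigr)-8|\alpha_{m,n}|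 .$$ Then $\min_{(m,n)\in\mathbb Z^2}R_{m,n}$ exists, and the Lebesgue measure (on $\mathbb R$) of the spectrum $\sigma(J)\subset\mathbb R$ satisfies $$|\sigma(J)|\le\min_{(m,n)\in\mathbb Z^2}R_{m,n}.$$ -/

import Mathlib

open scoped lp ComplexConjugate InnerProductSpace

noncomputable section

namespace JBJ

section General

variable {H : Type*} [NormedAddCommGroup H] [InnerProductSpace ℂ H]

/-- The translation `(shift k u) q = u (q + k)` on `ℓ²(ℤ, H)`. -/
def shift (k : ℤ) : ℓ²(ℤ, H) →L[ℂ] ℓ²(ℤ, H) :=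
  LinearMap.mkContinuous
    { toFun := fun u => ⟨fun q => u (q + k), memℓp_gen (by
        have h := (lp.memℓp u).summable (by norm_num)
        exact (Equiv.addRight k).summable_iff.mpr h)⟩
      map_add' := fun _ _ => by ext; rfl
      map_smul' := fun _ _ => by ext; rfl }
    1
    fun u => by
      refine lp.norm_le_of_tsum_le (by norm_num) (by positivity) ?_
      rw [one_mul, lp.norm_rpow_eq_tsum (by norm_num) u]
      exact ((Equiv.addRight k).tsum_eq (fun q => ‖u q‖ ^ (2 : ENNReal).toReal)).le

@[simp]
theorem shift_apply (k : ℤ) (u : ℓ²(ℤ, H)) (q : ℤ) : shift k u q = u (q + k) := rfl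

/-- The family `T` of operators is uniformly bounded. -/
def UnifBounded (T : ℤ → H →L[ℂ] H) : Prop := ∃ K : ℝ, 0 ≤ K ∧ ∀ q, ‖T q‖ ≤ K

open Classical in
/-- The block diagonal operator `(diag T u) q = T q (u q)` on `ℓ²(ℤ, H)` for a uniformly bounded
family `T` (by convention `0` for an unbounded family). -/
def diag (T : ℤ → H →L[ℂ] H) : ℓ²(ℤ, H) →L[ℂ] ℓ²(ℤ, H) :=
  if h : UnifBounded T then lp.mapCLM 2 T h.choose_spec.1 h.choose_spec.2 else 0

theorem diag_apply {T : ℤ → H →L[ℂ] H} (h : UnifBounded T) (u : ℓ²(ℤ, H)) (q : ℤ) :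
    diag T u q = T q (u q) := by
  rw [diag, dif_pos h]
  rfl

theorem norm_diag_le {T : ℤ → H →L[ℂ] H} {K : ℝ} (hK : 0 ≤ K) (hT : ∀ q, ‖T q‖ ≤ K) :
    ‖diag T‖ ≤ K := by
  have h : UnifBounded T := ⟨K, hK, hT⟩
  have : diag T = lp.mapCLM 2 T hK hT := by
    ext u q
    rw [diag_apply h]
    rfl
  rw [this]
  exact lp.norm_mapCLM_le 2 T hK hT

/-- The tridiagonal operator
`(tridiag L D U u) q = L (q - 1) (u (q - 1)) + D q (u q) + U q (u (q + 1))` on `ℓ²(ℤ, H)`,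
for uniformly bounded families `L`, `D`, `U` of operators on `H`. -/
def tridiag (L D U : ℤ → H →L[ℂ] H) : ℓ²(ℤ, H) →L[ℂ] ℓ²(ℤ, H) :=
  (shift (-1)).comp (diag L) + diag D + (diag U).comp (shift 1)

theorem tridiag_apply {L D U : ℤ → H →L[ℂ] H} (hL : UnifBounded L) (hD : UnifBounded D)
    (hU : UnifBounded U) (u : ℓ²(ℤ, H)) (q : ℤ) :
    tridiag L D U u q = L (q - 1) (u (q - 1)) + D q (u q) + U q (u (q + 1)) := by
  simp only [tridiag, _root_.add_apply, ContinuousLinearMap.comp_apply,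
    lp.coeFn_add, Pi.add_apply, shift_apply, diag_apply hL, diag_apply hD, diag_apply hU,
    ← sub_eq_add_neg]

theorem norm_shift_apply_le (k : ℤ) (u : ℓ²(ℤ, H)) : ‖shift k u‖ ≤ ‖u‖ := by
  rw [← one_mul ‖u‖]
  exact (shift (H := H) k).le_of_opNorm_le (LinearMap.mkContinuous_norm_le _ zero_le_one _) u

theorem norm_tridiag_le {L D U : ℤ → H →L[ℂ] H} {K : ℝ} (hK : 0 ≤ K) (hL : ∀ q, ‖L q‖ ≤ K)
    (hD : ∀ q, ‖D q‖ ≤ K) (hU : ∀ q, ‖U q‖ ≤ K) : ‖tridiag L D U‖ ≤ 3 * K := by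
  refine ContinuousLinearMap.opNorm_le_bound _ (by positivity) fun u => ?_
  have h1 : ‖shift (-1) (diag L u)‖ ≤ K * ‖u‖ :=
    (norm_shift_apply_le _ _).trans ((diag L).le_of_opNorm_le (norm_diag_le hK hL) u)
  have h2 : ‖diag D u‖ ≤ K * ‖u‖ := (diag D).le_of_opNorm_le (norm_diag_le hK hD) u
  have h3 : ‖diag U (shift 1 u)‖ ≤ K * ‖u‖ :=
    ((diag U).le_of_opNorm_le (norm_diag_le hK hU) _).trans
      (mul_le_mul_of_nonneg_left (norm_shift_apply_le 1 u) hK)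
  have h4 : ‖shift (-1) (diag L u) + diag D u + diag U (shift 1 u)‖ ≤
      ‖shift (-1) (diag L u)‖ + ‖diag D u‖ + ‖diag U (shift 1 u)‖ := norm_add₃_le
  have h5 : tridiag L D U u = shift (-1) (diag L u) + diag D u + diag U (shift 1 u) := rfl
  rw [h5]
  linarith

theorem inner_tridiag {L D U : ℤ → H →L[ℂ] H} (hL : UnifBounded L) (hD : UnifBounded D)
    (hU : UnifBounded U) (hDD : ∀ q x y, ⟪D q x, y⟫_ℂ = ⟪x, D q y⟫_ℂ)
    (hLU : ∀ q x y, ⟪L q x, y⟫_ℂ = ⟪x, U q y⟫_ℂ) (u v : ℓ²(ℤ, H)) :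
    ⟪tridiag L D U u, v⟫_ℂ = ⟪u, tridiag L D U v⟫_ℂ := by
  have hUL : ∀ q x y, ⟪U q x, y⟫_ℂ = ⟪x, L q y⟫_ℂ := fun q x y => by
    rw [← inner_conj_symm, ← hLU, inner_conj_symm]
  have h1 : ∀ u v : ℓ²(ℤ, H), ⟪(shift (-1)) (diag L u), v⟫_ℂ = ⟪u, diag U (shift 1 v)⟫_ℂ := by
    intro u v
    rw [lp.inner_eq_tsum, lp.inner_eq_tsum, ← (Equiv.addRight (1 : ℤ)).tsum_eq]
    refine tsum_congr fun q => ?_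
    simp [diag_apply hL, diag_apply hU, hLU]
  have h2 : ⟪diag D u, v⟫_ℂ = ⟪u, diag D v⟫_ℂ := by
    rw [lp.inner_eq_tsum, lp.inner_eq_tsum]
    refine tsum_congr fun q => ?_
    simp [diag_apply hD, hDD]
  have h3 : ⟪diag U (shift 1 u), v⟫_ℂ = ⟪u, (shift (-1)) (diag L v)⟫_ℂ := by
    rw [← inner_conj_symm, ← h1, inner_conj_symm]
  simp only [tridiag, _root_.add_apply, ContinuousLinearMap.comp_apply,
    inner_add_left, inner_add_right, h1, h2, h3]
  ring

end General

/-- Multiplication by the scalar `z` on `ℂ`. -/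
def mulOp (z : ℂ) : ℂ →L[ℂ] ℂ := z • ContinuousLinearMap.id ℂ ℂ

/-- The Hermitian one-dimensional Jacobi operator `J({d_r}, {w_r})` on `ℓ²(ℤ)`: real entries `d r`
on the main diagonal, `w r` above it and the conjugates of `w r` below it, that is
`(jacobi d w x) r = conj (w (r - 1)) * x (r - 1) + d r * x r + w r * x (r + 1)`. -/
def jacobi (d : ℤ → ℝ) (w : ℤ → ℂ) : ℓ²(ℤ, ℂ) →L[ℂ] ℓ²(ℤ, ℂ) :=
  tridiag (fun r => mulOp (conj (w r))) (fun r => mulOp (d r)) (fun r => mulOp (w r))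

/-- The Jacobi-block-Jacobi operator `(J u) q = A (q - 1) (u (q - 1)) + B q (u q) + A q (u (q + 1))`
on `ℓ²(ℤ, ℓ²(ℤ))` whose blocks are the one-dimensional Jacobi operators
`A q = J({a_{q,r}}, {α_{q,r}})` and `B q = J({c_{q,r}}, {b_{q,r}})`. -/
def jacobiBlockJacobi (a : ℤ → ℤ → ℝ) (α : ℤ → ℤ → ℂ) (c : ℤ → ℤ → ℝ) (b : ℤ → ℤ → ℂ) :
    ℓ²(ℤ, ℓ²(ℤ, ℂ)) →L[ℂ] ℓ²(ℤ, ℓ²(ℤ, ℂ)) :=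
  tridiag (fun q => jacobi (a q) (α q)) (fun q => jacobi (c q) (b q))
    (fun q => jacobi (a q) (α q))

/-- A double sequence is `(p₁, p₂)`-periodic. -/
def IsPeriodic {E : Type*} (p₁ p₂ : ℕ) (w : ℤ → ℤ → E) : Prop :=
  ∀ q r k₁ k₂ : ℤ, w (q + k₁ * p₁) (r + k₂ * p₂) = w q r

/-- The quantity `R_{m,n}`. -/
def R (p₁ p₂ : ℕ) (a : ℤ → ℤ → ℝ) (α b : ℤ → ℤ → ℂ) (m n : ℤ) : ℝ :=
  4 * ∑ j ∈ Finset.Icc (1 : ℤ) p₁, (‖b j n‖ + 2 * ‖α j n‖)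
    + 4 * ∑ k ∈ Finset.Icc (1 : ℤ) p₂, (|a m k| + 2 * ‖α m k‖) - 8 * ‖α m n‖

/-! Consistency of the definitions: for periodic entries the operator acts by the expected formula,
it is self-adjoint, and its spectrum is real. -/

theorem IsPeriodic.bounded {E : Type*} [NormedAddCommGroup E] {p₁ p₂ : ℕ} (h₁ : 0 < p₁)
    (h₂ : 0 < p₂) {w : ℤ → ℤ → E} (h : IsPeriodic p₁ p₂ w) : ∃ K : ℝ, 0 ≤ K ∧ ∀ q r, ‖w q r‖ ≤ K := by
  refine ⟨∑ i ∈ Finset.range p₁, ∑ j ∈ Finset.range p₂, ‖w i j‖,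
    Finset.sum_nonneg fun _ _ => Finset.sum_nonneg fun _ _ => norm_nonneg _, fun q r => ?_⟩
  have e : w q r = w ((q % p₁).toNat : ℤ) ((r % p₂).toNat : ℤ) := by
    rw [Int.toNat_of_nonneg (Int.emod_nonneg _ (by omega)),
      Int.toNat_of_nonneg (Int.emod_nonneg _ (by omega)),
      ← h (q % p₁) (r % p₂) (q / p₁) (r / p₂)]
    congr 1
    · rw [mul_comm]; exact (Int.emod_add_mul_ediv q p₁).symm
    · rw [mul_comm]; exact (Int.emod_add_mul_ediv r p₂).symm
  have hq := Int.emod_lt_of_pos q (by omega : (0 : ℤ) < p₁)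
  have hr := Int.emod_lt_of_pos r (by omega : (0 : ℤ) < p₂)
  rw [e]
  refine (Finset.single_le_sum (f := fun j : ℕ => ‖w ((q % p₁).toNat : ℤ) j‖)
    (fun _ _ => norm_nonneg _) (Finset.mem_range.2 (by omega : (r % p₂).toNat < p₂))).trans ?_
  exact Finset.single_le_sum (f := fun i : ℕ => ∑ j ∈ Finset.range p₂, ‖w i j‖)
    (fun _ _ => Finset.sum_nonneg fun _ _ => norm_nonneg _)
    (Finset.mem_range.2 (by omega : (q % p₁).toNat < p₁))

theorem norm_mulOp_le (z : ℂ) : ‖mulOp z‖ ≤ ‖z‖ := by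
  simp [mulOp, norm_smul]

section Scalar

variable {d : ℤ → ℝ} {w : ℤ → ℂ} {K : ℝ}

theorem unifBounded_mulOp {z : ℤ → ℂ} (hK : 0 ≤ K) (hz : ∀ r, ‖z r‖ ≤ K) :
    UnifBounded fun r => mulOp (z r) :=
  ⟨K, hK, fun r => (norm_mulOp_le _).trans (hz r)⟩

theorem jacobi_apply (hK : 0 ≤ K) (hd : ∀ r, ‖d r‖ ≤ K) (hw : ∀ r, ‖w r‖ ≤ K) (x : ℓ²(ℤ, ℂ))
    (r : ℤ) :
    jacobi d w x r = conj (w (r - 1)) * x (r - 1) + d r * x r + w r * x (r + 1) := by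
  rw [jacobi, tridiag_apply (unifBounded_mulOp hK (by simpa using hw))
    (unifBounded_mulOp hK (by simpa using hd)) (unifBounded_mulOp hK hw)]
  simp [mulOp]

theorem norm_jacobi_le (hK : 0 ≤ K) (hd : ∀ r, ‖d r‖ ≤ K) (hw : ∀ r, ‖w r‖ ≤ K) :
    ‖jacobi d w‖ ≤ 3 * K :=
  norm_tridiag_le hK (fun r => (norm_mulOp_le _).trans (by simpa using hw r))
    (fun r => (norm_mulOp_le _).trans (by simpa using hd r))
    (fun r => (norm_mulOp_le _).trans (hw r))

theorem inner_jacobi (hK : 0 ≤ K) (hd : ∀ r, ‖d r‖ ≤ K) (hw : ∀ r, ‖w r‖ ≤ K) (x y : ℓ²(ℤ, ℂ)) :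
    ⟪jacobi d w x, y⟫_ℂ = ⟪x, jacobi d w y⟫_ℂ :=
  inner_tridiag (unifBounded_mulOp hK (by simpa using hw))
    (unifBounded_mulOp hK (by simpa using hd)) (unifBounded_mulOp hK hw)
    (fun q x y => by simp [mulOp]; ring) (fun q x y => by simp [mulOp]; ring) x y

end Scalar

section Periodic

variable {p₁ p₂ : ℕ} {a c : ℤ → ℤ → ℝ} {α b : ℤ → ℤ → ℂ}

theorem unifBounded_jacobi (h₁ : 0 < p₁) (h₂ : 0 < p₂) (ha : IsPeriodic p₁ p₂ a)
    (hα : IsPeriodic p₁ p₂ α) : UnifBounded fun q => jacobi (a q) (α q) := by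
  obtain ⟨K, hK, hK'⟩ := ha.bounded h₁ h₂
  obtain ⟨M, hM, hM'⟩ := hα.bounded h₁ h₂
  exact ⟨3 * max K M, by positivity, fun q => norm_jacobi_le (le_max_of_le_left hK)
    (fun r => (hK' q r).trans (le_max_left _ _)) fun r => (hM' q r).trans (le_max_right _ _)⟩

theorem jacobi_apply_of_isPeriodic (h₁ : 0 < p₁) (h₂ : 0 < p₂) (ha : IsPeriodic p₁ p₂ a)
    (hα : IsPeriodic p₁ p₂ α) (q : ℤ) (x : ℓ²(ℤ, ℂ)) (r : ℤ) :
    jacobi (a q) (α q) x r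
      = conj (α q (r - 1)) * x (r - 1) + a q r * x r + α q r * x (r + 1) := by
  obtain ⟨K, hK, hK'⟩ := ha.bounded h₁ h₂
  obtain ⟨M, hM, hM'⟩ := hα.bounded h₁ h₂
  exact jacobi_apply (le_max_of_le_left hK)
    (fun r => (hK' q r).trans (le_max_left _ _)) (fun r => (hM' q r).trans (le_max_right _ _)) x r

theorem inner_jacobi_of_isPeriodic (h₁ : 0 < p₁) (h₂ : 0 < p₂) (ha : IsPeriodic p₁ p₂ a)
    (hα : IsPeriodic p₁ p₂ α) (q : ℤ) (x y : ℓ²(ℤ, ℂ)) :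
    ⟪jacobi (a q) (α q) x, y⟫_ℂ = ⟪x, jacobi (a q) (α q) y⟫_ℂ := by
  obtain ⟨K, hK, hK'⟩ := ha.bounded h₁ h₂
  obtain ⟨M, hM, hM'⟩ := hα.bounded h₁ h₂
  exact inner_jacobi (le_max_of_le_left hK)
    (fun r => (hK' q r).trans (le_max_left _ _)) (fun r => (hM' q r).trans (le_max_right _ _)) x y

theorem jacobiBlockJacobi_apply (h₁ : 0 < p₁) (h₂ : 0 < p₂) (ha : IsPeriodic p₁ p₂ a)
    (hα : IsPeriodic p₁ p₂ α) (hc : IsPeriodic p₁ p₂ c) (hb : IsPeriodic p₁ p₂ b)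
    (u : ℓ²(ℤ, ℓ²(ℤ, ℂ))) (q : ℤ) :
    jacobiBlockJacobi a α c b u q = jacobi (a (q - 1)) (α (q - 1)) (u (q - 1))
      + jacobi (c q) (b q) (u q) + jacobi (a q) (α q) (u (q + 1)) :=
  tridiag_apply (unifBounded_jacobi h₁ h₂ ha hα) (unifBounded_jacobi h₁ h₂ hc hb)
    (unifBounded_jacobi h₁ h₂ ha hα) u q

theorem isSelfAdjoint_jacobiBlockJacobi (h₁ : 0 < p₁) (h₂ : 0 < p₂) (ha : IsPeriodic p₁ p₂ a)
    (hα : IsPeriodic p₁ p₂ α) (hc : IsPeriodic p₁ p₂ c) (hb : IsPeriodic p₁ p₂ b) :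
    IsSelfAdjoint (jacobiBlockJacobi a α c b) :=
  ContinuousLinearMap.isSelfAdjoint_iff_isSymmetric.2 fun u v =>
    inner_tridiag (unifBounded_jacobi h₁ h₂ ha hα) (unifBounded_jacobi h₁ h₂ hc hb)
      (unifBounded_jacobi h₁ h₂ ha hα) (inner_jacobi_of_isPeriodic h₁ h₂ hc hb)
      (inner_jacobi_of_isPeriodic h₁ h₂ ha hα) u v

theorem spectrum_jacobiBlockJacobi_subset (h₁ : 0 < p₁) (h₂ : 0 < p₂) (ha : IsPeriodic p₁ p₂ a)
    (hα : IsPeriodic p₁ p₂ α) (hc : IsPeriodic p₁ p₂ c) (hb : IsPeriodic p₁ p₂ b) :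
    spectrum ℂ (jacobiBlockJacobi a α c b) ⊆ Set.range ((↑) : ℝ → ℂ) := fun z hz =>
  ⟨z.re, ((isSelfAdjoint_jacobiBlockJacobi h₁ h₂ ha hα hc hb).mem_spectrum_eq_re hz).symm⟩

end Periodic

end JBJ

end

/-! View J as a difference operator on ℤ² with edges in the four directions `edgeStep`. Tile ℤ² by
the translates of the p₁ × p₂ box with corner (m + 1, n + 1) and delete all edges between different
boxes. By periodicity, what remains is one Hermitian matrix M acting in every box. Since 2|xy| ≤
|x|² + |y|², the form of the deleted part is bounded in absolute value by a diagonal form E, whose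
entry at a site is the total weight of the deleted edges there (`abs_le_of_hasSum_band`). Hence M -
E ≤ J ≤ M + E, with M and E acting cellwise.

An operator squeezed between cellwise matrices A ≤ B has its spectrum in the union of the intervals
[λ_j(A), λ_j(B)], and no Floquet transform is needed to see this. If t avoids all of them, the
eigenvectors of B below t and those of A above t span complementary subspaces V and W of the cell
space. The form of J - t is negative on V-valued and positive on W-valued functions, with a gap, and
this forces invertibility (`isUnit_sub_of_gap`). The lengths of the intervals add up to tr(B - A) =
2 tr E (`volume_spectrum_le_of_cellwise_le`).

Every deleted edge enters E at both of its ends, so the bound is four times the deleted weight per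
box. Counting the edges that leave a box gives exactly R_{m,n} (`sum_norm_cut_edgeWeight`). By
periodicity R takes finitely many values, so the best (m, n) is attained. -/

noncomputable section

namespace JBJ

/-! ### Eigenvalue comparison for Hermitian forms in finite dimension. -/

section FiniteDimensional

variable {E : Type*} [NormedAddCommGroup E] [InnerProductSpace ℂ E]

theorem re_inner_real_smul (c : ℝ) (y : E) : (⟪y, (c : ℂ) • y⟫_ℂ).re = c * ‖y‖ ^ 2 := by
  rw [inner_smul_right, Complex.re_ofReal_mul, ← inner_self_eq_norm_sq (𝕜 := ℂ)]
  rfl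

theorem re_inner_eq_sum_of_eigenbasis {ι : Type*} [Fintype ι] (v : OrthonormalBasis ι ℂ E)
    {A : E →ₗ[ℂ] E} {l : ι → ℝ} (hA : ∀ i, A (v i) = (l i : ℂ) • v i) (y : E) :
    (⟪y, A y⟫_ℂ).re = ∑ i, l i * ‖⟪v i, y⟫_ℂ‖ ^ 2 := by
  have h : A y = ∑ i, ⟪v i, y⟫_ℂ • (l i : ℂ) • v i := by
    conv_lhs => rw [← v.sum_repr' y]
    simp [hA]
  rw [h, inner_sum, Complex.re_sum]
  refine Finset.sum_congr rfl fun i _ => ?_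
  rw [inner_smul_right, inner_smul_right, mul_left_comm, ← inner_conj_symm y (v i),
    Complex.mul_conj, ← Complex.ofReal_mul, Complex.ofReal_re, Complex.normSq_eq_norm_sq]

theorem inner_eq_zero_of_mem_span {ι : Type*} [Fintype ι] (v : OrthonormalBasis ι ℂ E) {s : Set ι}
    {y : E} (hy : y ∈ Submodule.span ℂ (v '' s)) {i : ι} (hi : i ∉ s) : ⟪v i, y⟫_ℂ = 0 := by
  induction hy using Submodule.span_induction with
  | mem x hx =>
    obtain ⟨j, hj, rfl⟩ := hx
    exact v.orthonormal.2 fun h => hi (h ▸ hj)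
  | zero => simp
  | add x y _ _ hx hy => rw [inner_add_right, hx, hy, add_zero]
  | smul a x _ hx => rw [inner_smul_right, hx, mul_zero]

/-- On the span of the eigenvectors with eigenvalue below `t`, the form of an operator with an
orthonormal eigenbasis stays below `t` with a uniform gap. -/
theorem exists_gap_below {ι : Type*} [Fintype ι] (v : OrthonormalBasis ι ℂ E)
    {A : E →ₗ[ℂ] E} {l : ι → ℝ} (hA : ∀ i, A (v i) = (l i : ℂ) • v i) (t : ℝ) :
    ∃ δ > 0, ∀ y ∈ Submodule.span ℂ (v '' {i | l i < t}),
      (⟪y, A y⟫_ℂ).re ≤ (t - δ) * ‖y‖ ^ 2 := by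
  obtain ⟨κ, hκ, hκ'⟩ : ∃ κ < t, ∀ i, l i < t → l i ≤ κ := by
    have hs : ({i | l i < t}).Finite := Set.toFinite _
    by_cases hne : ({i | l i < t}).Nonempty
    · obtain ⟨i, hi, h⟩ := hs.exists_maximalFor l _ hne
      exact ⟨l i, hi, fun j hj => (le_total (l i) (l j)).elim (fun h' => h hj h') id⟩
    · exact ⟨t - 1, by linarith, fun i hi => (hne ⟨i, hi⟩).elim⟩
  refine ⟨t - κ, by linarith, fun y hy => ?_⟩
  rw [re_inner_eq_sum_of_eigenbasis v hA, ← v.sum_sq_norm_inner_right y, sub_sub_cancel,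
    Finset.mul_sum]
  refine Finset.sum_le_sum fun i _ => ?_
  by_cases hi : l i < t
  · exact mul_le_mul_of_nonneg_right (hκ' i hi) (by positivity)
  · simp [inner_eq_zero_of_mem_span v hy (show i ∉ {i | l i < t} from hi)]

theorem finrank_span_orthonormalBasis {ι : Type*} [Fintype ι] (v : OrthonormalBasis ι ℂ E)
    (s : Finset ι) : Module.finrank ℂ (Submodule.span ℂ (v '' (s : Set ι))) = s.card := by
  classical
  rw [← Finset.coe_image, finrank_span_finset_eq_card,
    Finset.card_image_of_injective _ v.orthonormal.linearIndependent.injective]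
  rw [Finset.coe_image]
  exact v.orthonormal.linearIndependent.linearIndepOn_id.mono (Set.image_subset_range _ _)

variable [FiniteDimensional ℂ E]

/-- If `A ≤ B`, then the spectral subspaces of `B` below `t` and of `A` above `t` are disjoint, and
each form has a gap at `t` on its subspace. -/
theorem exists_disjoint_spectral_subspaces {A B : E →ₗ[ℂ] E} (hA : A.IsSymmetric)
    (hB : B.IsSymmetric) (hAB : ∀ y, (⟪y, A y⟫_ℂ).re ≤ (⟪y, B y⟫_ℂ).re) {n : ℕ}
    (hn : Module.finrank ℂ E = n) (t : ℝ) :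
    ∃ V W : Submodule ℂ E, Disjoint V W ∧
      Module.finrank ℂ V = (Finset.univ.filter fun i => hB.eigenvalues hn i < t).card ∧
      Module.finrank ℂ W = (Finset.univ.filter fun i => t < hA.eigenvalues hn i).card ∧
      ∃ δ > 0, (∀ y ∈ V, (⟪y, B y⟫_ℂ).re ≤ (t - δ) * ‖y‖ ^ 2) ∧
        ∀ y ∈ W, (t + δ) * ‖y‖ ^ 2 ≤ (⟪y, A y⟫_ℂ).re := by
  obtain ⟨δ₁, hδ₁, h₁⟩ := exists_gap_below (hB.eigenvectorBasis hn)
    (hB.apply_eigenvectorBasis hn) t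
  -- The eigenvalues of A above t are those of -A below -t.
  obtain ⟨δ₂, hδ₂, h₂⟩ := exists_gap_below (A := -A) (l := fun i => -hA.eigenvalues hn i)
    (hA.eigenvectorBasis hn) (fun i => by
      rw [LinearMap.neg_apply, hA.apply_eigenvectorBasis hn, Complex.ofReal_neg, neg_smul]; rfl) (-t)
  have hset : {i | -hA.eigenvalues hn i < -t} = {i | t < hA.eigenvalues hn i} := by
    ext i; simp
  rw [hset] at h₂
  set δ := min δ₁ δ₂
  have k₁ : ∀ y ∈ Submodule.span ℂ (hB.eigenvectorBasis hn '' {i | hB.eigenvalues hn i < t}),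
      (⟪y, B y⟫_ℂ).re ≤ (t - δ) * ‖y‖ ^ 2 := fun y hy => (h₁ y hy).trans
    (mul_le_mul_of_nonneg_right (by linarith [min_le_left δ₁ δ₂]) (by positivity))
  have k₂ : ∀ y ∈ Submodule.span ℂ (hA.eigenvectorBasis hn '' {i | t < hA.eigenvalues hn i}),
      (t + δ) * ‖y‖ ^ 2 ≤ (⟪y, A y⟫_ℂ).re := fun y hy => by
    have h := h₂ y hy
    rw [LinearMap.neg_apply, inner_neg_right, Complex.neg_re] at h
    have h' : (t + δ) * ‖y‖ ^ 2 ≤ (t + δ₂) * ‖y‖ ^ 2 :=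
      mul_le_mul_of_nonneg_right (by linarith [min_le_right δ₁ δ₂]) (by positivity)
    linarith
  have hδ : 0 < δ := lt_min hδ₁ hδ₂
  refine ⟨_, _, ?_, ?_, ?_, δ, hδ, k₁, k₂⟩
  · rw [Submodule.disjoint_def]
    intro y hy hy'
    -- A nonzero common vector would give (t + δ)‖y‖² ≤ ⟪y, A y⟫ ≤ ⟪y, B y⟫ ≤ (t - δ)‖y‖².
    have : 0 < ‖y‖ ^ 2 → False := fun h => by nlinarith [k₁ y hy, k₂ y hy', hAB y]
    by_contra hne
    exact this (by positivity)
  · rw [← finrank_span_orthonormalBasis (hB.eigenvectorBasis hn), Finset.coe_filter_univ]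
  · rw [← finrank_span_orthonormalBasis (hA.eigenvectorBasis hn), Finset.coe_filter_univ]

theorem card_eigenvalues_lt_add_card_lt_eigenvalues_le {A B : E →ₗ[ℂ] E} (hA : A.IsSymmetric)
    (hB : B.IsSymmetric) (hAB : ∀ y, (⟪y, A y⟫_ℂ).re ≤ (⟪y, B y⟫_ℂ).re) {n : ℕ}
    (hn : Module.finrank ℂ E = n) (t : ℝ) :
    (Finset.univ.filter fun i => hB.eigenvalues hn i < t).card
      + (Finset.univ.filter fun i => t < hA.eigenvalues hn i).card ≤ n := by
  obtain ⟨V, W, hd, hV, hW, -⟩ := exists_disjoint_spectral_subspaces hA hB hAB hn t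
  rw [← hV, ← hW, ← hn]
  exact Submodule.finrank_add_finrank_le_of_disjoint hd

/-- Weyl's monotonicity principle. -/
theorem eigenvalues_le_eigenvalues {A B : E →ₗ[ℂ] E} (hA : A.IsSymmetric)
    (hB : B.IsSymmetric) (hAB : ∀ y, (⟪y, A y⟫_ℂ).re ≤ (⟪y, B y⟫_ℂ).re) {n : ℕ}
    (hn : Module.finrank ℂ E = n) (j : Fin n) : hA.eigenvalues hn j ≤ hB.eigenvalues hn j := by
  by_contra! h
  obtain ⟨t, ht, ht'⟩ := exists_between h
  have hc := card_eigenvalues_lt_add_card_lt_eigenvalues_le hA hB hAB hn t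
  -- Eigenvalues are listed in decreasing order: the n - j eigenvalues of B from j on lie below t
  -- and the j + 1 eigenvalues of A up to j lie above it, one too many in total.
  have h₁ : Finset.Ici j ⊆ Finset.univ.filter fun i => hB.eigenvalues hn i < t := fun i hi => by
    simp only [Finset.mem_Ici, Finset.mem_filter, Finset.mem_univ, true_and] at hi ⊢
    exact (hB.eigenvalues_antitone hn hi).trans_lt ht
  have h₂ : Finset.Iic j ⊆ Finset.univ.filter fun i => t < hA.eigenvalues hn i := fun i hi => by
    simp only [Finset.mem_Iic, Finset.mem_filter, Finset.mem_univ, true_and] at hi ⊢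
    exact ht'.trans_le (hA.eigenvalues_antitone hn hi)
  have h₃ := Finset.card_le_card h₁
  have h₄ := Finset.card_le_card h₂
  rw [Fin.card_Ici] at h₃
  rw [Fin.card_Iic] at h₄
  omega

end FiniteDimensional

/-! ### Cellwise operators and the spectrum of an operator squeezed between two of them. -/

section Cellwise

variable {Γ : Type*} {E : Type*} [NormedAddCommGroup E] [InnerProductSpace ℂ E]

/-- The action of an operator on `E` in every coordinate of `ℓ²(Γ, E)`. -/
def cellwise (A : E →L[ℂ] E) : ℓ²(Γ, E) →L[ℂ] ℓ²(Γ, E) :=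
  lp.mapCLM 2 (fun _ => A) (norm_nonneg A) fun _ => le_rfl

theorem hasSum_re_inner (f g : ℓ²(Γ, E)) :
    HasSum (fun γ => (⟪f γ, g γ⟫_ℂ).re) (⟪f, g⟫_ℂ).re := by
  have h := lp.hasSum_inner (𝕜 := ℂ) f g
  exact Complex.hasSum_re h

theorem re_inner_cellwise_le {A B : E →L[ℂ] E} {f : ℓ²(Γ, E)}
    (h : ∀ γ, (⟪f γ, A (f γ)⟫_ℂ).re ≤ (⟪f γ, B (f γ)⟫_ℂ).re) :
    (⟪f, cellwise A f⟫_ℂ).re ≤ (⟪f, cellwise B f⟫_ℂ).re :=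
  hasSum_le h (hasSum_re_inner f (cellwise A f)) (hasSum_re_inner f (cellwise B f))

theorem re_inner_cellwise_smul_id (c : ℝ) (f : ℓ²(Γ, E)) :
    (⟪f, cellwise ((c : ℂ) • ContinuousLinearMap.id ℂ E) f⟫_ℂ).re = c * ‖f‖ ^ 2 := by
  have : cellwise ((c : ℂ) • ContinuousLinearMap.id ℂ E) f = (c : ℂ) • f := by
    ext γ
    rfl
  rw [this, re_inner_real_smul]

variable [CompleteSpace E]

/-- If the form of a symmetric operator `T` is below `t` on functions with values in `V` and above
`t` on functions with values in a complement `W` of `V`, then `t` lies in the resolvent set. -/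
theorem isUnit_sub_of_gap [FiniteDimensional ℂ E] {T : ℓ²(Γ, E) →L[ℂ] ℓ²(Γ, E)}
    (hT : ∀ f g, ⟪T f, g⟫_ℂ = ⟪f, T g⟫_ℂ) {V W : Submodule ℂ E} (hVW : IsCompl V W) {t δ : ℝ}
    (hδ : 0 < δ) (hV : ∀ f, (∀ γ, f γ ∈ V) → (⟪f, T f⟫_ℂ).re ≤ (t - δ) * ‖f‖ ^ 2)
    (hW : ∀ f, (∀ γ, f γ ∈ W) → (t + δ) * ‖f‖ ^ 2 ≤ (⟪f, T f⟫_ℂ).re) :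
    IsUnit (T - algebraMap ℂ _ (t : ℂ)) := by
  -- P projects onto V along W. It need not be orthogonal, since V and W come from eigenvectors of
  -- different operators.
  set P : E →L[ℂ] E := LinearMap.toContinuousLinearMap (V.projection W hVW)
  have hPV : ∀ y, P y ∈ V := fun y => Submodule.projection_apply_mem hVW y
  have hPW : ∀ y, y - P y ∈ W := fun y => by
    have h := Submodule.projection_add_projection_eq_self hVW y
    have h' : y - P y = W.projection V hVW.symm y := sub_eq_of_eq_add' h.symm
    rw [h']
    exact Submodule.projection_apply_mem hVW.symm y
  have hPP : ∀ y, P (P y) = P y := fun y => Submodule.projection_apply_left hVW ⟨P y, hPV y⟩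
  -- The reflection that is -1 on V and +1 on W turns the indefinite form of L = T - t into a
  -- coercive one.
  set S : ℓ²(Γ, E) →L[ℂ] ℓ²(Γ, E) := 1 - (2 : ℂ) • cellwise P with hS
  have hSS : S * S = 1 := by
    have : (cellwise P : ℓ²(Γ, E) →L[ℂ] ℓ²(Γ, E)) * cellwise P = cellwise P := by
      ext f γ
      exact hPP _
    rw [hS, sub_mul, mul_sub, mul_sub, smul_mul_smul_comm, this, one_mul, one_mul, mul_one]
    module
  have hSu : IsUnit (star S) := IsUnit.star ⟨⟨S, S, hSS, hSS⟩, rfl⟩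
  set L := T - algebraMap ℂ _ (t : ℂ) with hL
  have hLf : ∀ f, L f = T f - (t : ℂ) • f := fun f => by
    rw [hL, _root_.sub_apply, Algebra.algebraMap_eq_smul_one]
    rfl
  have key : IsUnit (star S * L) := by
    refine ContinuousLinearMap.isUnit_of_forall_le_norm_inner_map _ (c := ⟨δ / 2, by positivity⟩)
      (show (0 : ℝ) < δ / 2 by positivity) fun f => ?_
    change ‖f‖ ^ 2 * (δ / 2) ≤ _
    set v := cellwise P f with hv
    set w := f - v with hw
    have hSf : S f = w - v := by
      rw [hS, hw, hv]
      simp only [_root_.sub_apply, _root_.smul_apply,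
        one_apply_eq_self]
      module
    have hfv : f = v + w := by rw [hw]; abel
    have e : ⟪(star S * L) f, f⟫_ℂ = ⟪L f, w - v⟫_ℂ := by
      rw [mul_apply_eq_comp, ContinuousLinearMap.star_eq_adjoint,
        ContinuousLinearMap.adjoint_inner_left, hSf]
    have hLsym : ∀ f g, ⟪L f, g⟫_ℂ = ⟪f, L g⟫_ℂ := fun f g => by
      rw [hLf, hLf, inner_sub_left, inner_sub_right, hT, inner_smul_left, inner_smul_right,
        Complex.conj_ofReal]
    -- The cross terms cancel in the real part because L is symmetric.
    have e2 : (⟪L f, w - v⟫_ℂ).re = (⟪w, L w⟫_ℂ).re - (⟪v, L v⟫_ℂ).re := by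
      have : (⟪L v, w⟫_ℂ).re = (⟪L w, v⟫_ℂ).re := by
        rw [hLsym, ← inner_conj_symm, Complex.conj_re]
      have hLfvw : L f = L v + L w := by rw [← map_add, ← hfv]
      rw [hLfvw, inner_add_left, inner_sub_right (L v), inner_sub_right (L w)]
      simp only [Complex.add_re, Complex.sub_re, this, hLsym w w, hLsym v v]
      ring
    have hre : ∀ g, (⟪g, L g⟫_ℂ).re = (⟪g, T g⟫_ℂ).re - t * ‖g‖ ^ 2 := fun g => by
      rw [hLf, inner_sub_right, Complex.sub_re, re_inner_real_smul]
    have h1 := hV v fun γ => hPV _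
    have h2 := hW w fun γ => hPW _
    -- As v and w need not be orthogonal, a factor 2 is lost here; hence the constant δ / 2.
    have h3 : ‖f‖ ^ 2 ≤ 2 * (‖v‖ ^ 2 + ‖w‖ ^ 2) := by
      have : ‖f‖ ≤ ‖v‖ + ‖w‖ := hfv ▸ norm_add_le v w
      nlinarith [norm_nonneg f, sq_nonneg (‖v‖ - ‖w‖)]
    rw [e]
    refine le_trans ?_ ((le_abs_self _).trans (Complex.abs_re_le_norm _))
    rw [e2, hre, hre]
    nlinarith
  obtain ⟨s, hs⟩ := hSu
  rw [← hs] at key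
  exact (Units.isUnit_units_mul s L).1 key

/-- An operator squeezed between the cellwise operators of `A` and `B` has its spectrum in the union
of the intervals between corresponding eigenvalues, hence of measure at most `tr B - tr A`. -/
theorem volume_spectrum_le_of_cellwise_le [FiniteDimensional ℂ E]
    {T : ℓ²(Γ, E) →L[ℂ] ℓ²(Γ, E)} (hT : ∀ f g, ⟪T f, g⟫_ℂ = ⟪f, T g⟫_ℂ) {A B : E →L[ℂ] E}
    (hA : (A : E →ₗ[ℂ] E).IsSymmetric) (hB : (B : E →ₗ[ℂ] E).IsSymmetric)
    (hAB : ∀ y, (⟪y, A y⟫_ℂ).re ≤ (⟪y, B y⟫_ℂ).re)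
    (hAT : ∀ f, (⟪f, cellwise A f⟫_ℂ).re ≤ (⟪f, T f⟫_ℂ).re)
    (hTB : ∀ f, (⟪f, T f⟫_ℂ).re ≤ (⟪f, cellwise B f⟫_ℂ).re) :
    MeasureTheory.volume {x : ℝ | (x : ℂ) ∈ spectrum ℂ T} ≤
      ENNReal.ofReal ((LinearMap.trace ℂ E (B - A : E →L[ℂ] E)).re) := by
  have hsub : {x : ℝ | (x : ℂ) ∈ spectrum ℂ T} ⊆
      ⋃ j, Set.Icc (hA.eigenvalues rfl j) (hB.eigenvalues rfl j) := by
    intro t ht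
    by_contra hnot
    simp only [Set.mem_iUnion, Set.mem_Icc, not_exists, not_and_or, not_le] at hnot
    obtain ⟨V, W, hd, hV, hW, δ, hδ, hVB, hWA⟩ :=
      exists_disjoint_spectral_subspaces hA hB hAB rfl t
    -- As t lies outside every interval, each index j is counted by V (λ_j(B) < t) or by W (t <
    -- λ_j(A)).
    have hle : Module.finrank ℂ E ≤ Module.finrank ℂ V + Module.finrank ℂ W := by
      rw [hV, hW]
      refine le_trans (le_of_eq ?_) (Finset.card_union_le _ _)
      rw [Finset.eq_univ_of_forall (s := _ ∪ _) fun j => ?_, Finset.card_univ, Fintype.card_fin]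
      simpa [or_comm] using hnot j
    have hVW : IsCompl V W := (Submodule.isCompl_iff_disjoint V W hle).2 hd
    refine ht ?_
    rw [spectrum.mem_resolventSet_iff, ← neg_sub]
    refine (isUnit_sub_of_gap hT hVW hδ (fun f hf => (hTB f).trans ?_)
      fun f hf => le_trans ?_ (hAT f)).neg
    · rw [← re_inner_cellwise_smul_id]
      refine re_inner_cellwise_le fun γ => (hVB _ (hf γ)).trans (le_of_eq ?_)
      rw [← re_inner_real_smul]
      rfl
    · rw [← re_inner_cellwise_smul_id]
      refine re_inner_cellwise_le fun γ => (le_of_eq ?_).trans (hWA _ (hf γ))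
      rw [← re_inner_real_smul]
      rfl
  have htr : (LinearMap.trace ℂ E (B - A : E →L[ℂ] E)).re
      = ∑ j, (hB.eigenvalues rfl j - hA.eigenvalues rfl j) := by
    rw [ContinuousLinearMap.toLinearMap_sub, map_sub, hB.trace_eq_sum_eigenvalues rfl,
      hA.trace_eq_sum_eigenvalues rfl, Finset.sum_sub_distrib]
    simp
  rw [htr, ENNReal.ofReal_sum_of_nonneg fun j _ =>
    sub_nonneg.2 (eigenvalues_le_eigenvalues hA hB hAB rfl j)]
  refine (MeasureTheory.measure_mono hsub).trans ((MeasureTheory.measure_iUnion_fintype_le _ _).trans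
    (le_of_eq ?_))
  simp [Real.volume_Icc]

end Cellwise

/-! ### Identification of ℓ²(ℤ, ℓ²(ℤ)) with functions on the cells of a tiling. -/

section Bases

theorem inner_single_single (z : ℤ × ℤ) (u : ℓ²(ℤ, ℓ²(ℤ, ℂ))) :
    ⟪(lp.single 2 z.1 (lp.single 2 z.2 (1 : ℂ) : ℓ²(ℤ, ℂ)) : ℓ²(ℤ, ℓ²(ℤ, ℂ))), u⟫_ℂ
      = u z.1 z.2 := by
  rw [lp.inner_single_left, lp.inner_single_left]
  simp

/-- The standard Hilbert basis of `ℓ²(ℤ, ℓ²(ℤ))`. -/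
def siteBasis : HilbertBasis (ℤ × ℤ) ℂ ℓ²(ℤ, ℓ²(ℤ, ℂ)) :=
  HilbertBasis.mkOfOrthogonalEqBot
    (v := fun z => lp.single 2 z.1 (lp.single 2 z.2 (1 : ℂ) : ℓ²(ℤ, ℂ)))
    (by
      classical
      rw [orthonormal_iff_ite]
      rintro ⟨q, r⟩ ⟨q', r'⟩
      rw [inner_single_single]
      by_cases h : q = q'
      · subst h
        by_cases h : r = r'
        · subst h; simp
        · simp [h]
      · simp [h])
    (by
      rw [Submodule.eq_bot_iff]
      intro u hu
      ext q r
      have := (Submodule.mem_orthogonal _ _).1 hu _ (Submodule.subset_span ⟨(q, r), rfl⟩)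
      rwa [inner_single_single] at this)

@[simp]
theorem siteBasis_repr (u : ℓ²(ℤ, ℓ²(ℤ, ℂ))) (z : ℤ × ℤ) : siteBasis.repr u z = u z.1 z.2 := by
  rw [HilbertBasis.repr_apply_apply, siteBasis, HilbertBasis.coe_mkOfOrthogonalEqBot,
    inner_single_single]

variable {Γ V : Type*} [Fintype V]

open Classical in
theorem inner_single_euclideanSingle (γ : Γ) (v : V) (f : ℓ²(Γ, EuclideanSpace ℂ V)) :
    ⟪(lp.single 2 γ (EuclideanSpace.single v (1 : ℂ)) : ℓ²(Γ, EuclideanSpace ℂ V)), f⟫_ℂ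
      = f γ v := by
  rw [lp.inner_single_left, EuclideanSpace.inner_single_left]
  simp

open Classical in
/-- The standard Hilbert basis of `ℓ²(Γ, ℂ^V)`, indexed by the sites of the tiling `e`. -/
def cellBasis (e : Γ × V ≃ ℤ × ℤ) : HilbertBasis (ℤ × ℤ) ℂ ℓ²(Γ, EuclideanSpace ℂ V) :=
  HilbertBasis.mkOfOrthogonalEqBot
    (v := fun z => lp.single 2 (e.symm z).1 (EuclideanSpace.single (e.symm z).2 (1 : ℂ)))
    (by
      rw [orthonormal_iff_ite]
      intro z z'
      obtain ⟨⟨γ, v⟩, rfl⟩ := e.surjective z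
      obtain ⟨⟨γ', v'⟩, rfl⟩ := e.surjective z'
      rw [inner_single_euclideanSingle, e.symm_apply_apply, e.symm_apply_apply]
      by_cases h : γ = γ'
      · subst h
        by_cases h : v = v'
        · subst h; simp
        · simp [h]
      · simp [h])
    (by
      rw [Submodule.eq_bot_iff]
      intro f hf
      ext γ v
      have := (Submodule.mem_orthogonal _ _).1 hf _ (Submodule.subset_span ⟨e (γ, v), rfl⟩)
      rw [inner_single_euclideanSingle] at this
      simpa using this)

@[simp]
theorem cellBasis_repr (e : Γ × V ≃ ℤ × ℤ) (f : ℓ²(Γ, EuclideanSpace ℂ V)) (z : ℤ × ℤ) :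
    (cellBasis e).repr f z = f (e.symm z).1 (e.symm z).2 := by
  rw [HilbertBasis.repr_apply_apply, cellBasis, HilbertBasis.coe_mkOfOrthogonalEqBot,
    inner_single_euclideanSingle]

/-- The isometry which collects the values on each cell of the tiling `e`. -/
def tile (e : Γ × V ≃ ℤ × ℤ) : ℓ²(ℤ, ℓ²(ℤ, ℂ)) ≃ₗᵢ[ℂ] ℓ²(Γ, EuclideanSpace ℂ V) :=
  siteBasis.repr.trans (cellBasis e).repr.symm

theorem tile_apply (e : Γ × V ≃ ℤ × ℤ) (u : ℓ²(ℤ, ℓ²(ℤ, ℂ))) (γ : Γ) (v : V) :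
    tile e u γ v = u (e (γ, v)).1 (e (γ, v)).2 := by
  have h : (cellBasis e).repr (tile e u) (e (γ, v)) = siteBasis.repr u (e (γ, v)) := by
    simp [tile, -cellBasis_repr, -siteBasis_repr]
  simpa using h

/-- Here and in `hasSum_re_inner_cell` the sum runs over the sites of ℤ², so forms on the two spaces
can be compared site by site. -/
theorem hasSum_re_inner_site (u w : ℓ²(ℤ, ℓ²(ℤ, ℂ))) :
    HasSum (fun z : ℤ × ℤ => (conj (u z.1 z.2) * w z.1 z.2).re) (⟪u, w⟫_ℂ).re := by
  have h := Complex.hasSum_re (siteBasis.hasSum_inner_mul_inner u w)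
  refine h.congr_fun fun z => ?_
  rw [← inner_conj_symm u, ← siteBasis.repr_apply_apply, ← siteBasis.repr_apply_apply,
    siteBasis_repr, siteBasis_repr]

theorem hasSum_re_inner_cell (e : Γ × V ≃ ℤ × ℤ) (f g : ℓ²(Γ, EuclideanSpace ℂ V)) :
    HasSum (fun z => (conj (f (e.symm z).1 (e.symm z).2) * g (e.symm z).1 (e.symm z).2).re)
      (⟪f, g⟫_ℂ).re := by
  have h := Complex.hasSum_re ((cellBasis e).hasSum_inner_mul_inner f g)
  refine h.congr_fun fun z => ?_
  rw [← inner_conj_symm f, ← (cellBasis e).repr_apply_apply, ← (cellBasis e).repr_apply_apply,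
    cellBasis_repr, cellBasis_repr]

end Bases

/-! ### Difference operators on ℤ² and the diagonal bound for their forms. -/

/-- A symmetric difference operator on functions on `ℤ²` with potential `c` and weight `W k z` on
the edge from `z` to `z + o k`. -/
def band {ι : Type*} [Fintype ι] (c : ℤ × ℤ → ℝ) (o : ι → ℤ × ℤ) (W : ι → ℤ × ℤ → ℂ)
    (x : ℤ × ℤ → ℂ) (z : ℤ × ℤ) : ℂ :=
  c z * x z + ∑ k, (W k z * x (z + o k) + conj (W k (z - o k)) * x (z - o k))

theorem abs_re_conj_mul_mul_le (w x y : ℂ) :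
    |(conj x * (w * y)).re| ≤ ‖w‖ * ((‖x‖ ^ 2 + ‖y‖ ^ 2) / 2) := by
  refine (Complex.abs_re_le_norm _).trans ?_
  rw [norm_mul, norm_mul, RCLike.norm_conj]
  nlinarith [mul_nonneg (norm_nonneg w) (sq_nonneg (‖x‖ - ‖y‖))]

/-- The form of a difference operator without potential is dominated by a diagonal form. -/
theorem abs_le_of_hasSum_band {ι : Type*} [Fintype ι] (o : ι → ℤ × ℤ) {W : ι → ℤ × ℤ → ℂ} {C : ℝ}
    (hW : ∀ k z, ‖W k z‖ ≤ C) {x : ℤ × ℤ → ℂ} (hx : Summable fun z => ‖x z‖ ^ 2) {Q D : ℝ}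
    (hQ : HasSum (fun z => (conj (x z) * band 0 o W x z).re) Q)
    (hD : HasSum (fun z => (∑ k, (‖W k z‖ + ‖W k (z - o k)‖)) * ‖x z‖ ^ 2) D) : |Q| ≤ D := by
  set g : ι → ℤ × ℤ → ℝ := fun k z => ‖W k z‖ * ‖x z‖ ^ 2 with hg
  set h : ι → ℤ × ℤ → ℝ := fun k z => ‖W k z‖ * ‖x (z + o k)‖ ^ 2 with hh
  have sg : ∀ k, Summable (g k) := fun k =>
    Summable.of_nonneg_of_le (fun z => by positivity)
      (fun z => mul_le_mul_of_nonneg_right (hW k z) (by positivity)) (hx.mul_left C)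
  have sh : ∀ k, Summable (h k) := fun k =>
    Summable.of_nonneg_of_le (fun z => by positivity)
      (fun z => mul_le_mul_of_nonneg_right (hW k z) (by positivity))
      (((Equiv.addRight (o k)).summable_iff.2 hx).mul_left C)
  have shift_hasSum : ∀ (k : ι) {F : ℤ × ℤ → ℝ} {s : ℝ}, HasSum F s →
      HasSum (fun z => F (z - o k)) s := fun k F s hF => (Equiv.subRight (o k)).hasSum_iff.2 hF
  -- The pointwise bound at z gives half of each adjacent edge's weight to both of its endpoints. It
  -- is not dominated pointwise by the diagonal form; the totals agree only after translating the
  -- sums by o k.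
  have h1 : HasSum (fun z => ∑ k, (((g k z + h k z) + (g k (z - o k) + h k (z - o k))) / 2))
      (∑ k, ((((∑' z, g k z) + ∑' z, h k z) + ((∑' z, g k z) + ∑' z, h k z)) / 2)) := by
    refine hasSum_sum fun k _ => HasSum.div_const (HasSum.add ?_ ?_) 2
    · exact (sg k).hasSum.add (sh k).hasSum
    · exact shift_hasSum k ((sg k).hasSum.add (sh k).hasSum)
  have h2 : HasSum (fun z => (∑ k, (‖W k z‖ + ‖W k (z - o k)‖)) * ‖x z‖ ^ 2)
      (∑ k, ((∑' z, g k z) + ∑' z, h k z)) := by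
    have : (fun z => (∑ k, (‖W k z‖ + ‖W k (z - o k)‖)) * ‖x z‖ ^ 2)
        = fun z => ∑ k, (g k z + h k (z - o k)) := by
      funext z
      simp only [hg, hh, Finset.sum_mul, sub_add_cancel, add_mul]
    rw [this]
    exact hasSum_sum fun k _ => (sg k).hasSum.add (shift_hasSum k (sh k).hasSum)
  have hS : D = ∑ k, ((((∑' z, g k z) + ∑' z, h k z) + ((∑' z, g k z) + ∑' z, h k z)) / 2) := by
    rw [hD.unique h2]
    exact Finset.sum_congr rfl fun k _ => by ring
  have hpt : ∀ z, |(conj (x z) * band 0 o W x z).re| ≤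
      ∑ k, (((g k z + h k z) + (g k (z - o k) + h k (z - o k))) / 2) := by
    intro z
    have : (conj (x z) * band 0 o W x z).re = ∑ k, ((conj (x z) * (W k z * x (z + o k))).re
        + (conj (x z) * (conj (W k (z - o k)) * x (z - o k))).re) := by
      simp only [band, Pi.zero_apply, Complex.ofReal_zero, zero_mul, zero_add, Finset.mul_sum,
        Complex.re_sum, mul_add, Complex.add_re]
    rw [this]
    refine (Finset.abs_sum_le_sum_abs _ _).trans (Finset.sum_le_sum fun k _ => ?_)
    refine (abs_add_le _ _).trans ((add_le_add (abs_re_conj_mul_mul_le _ _ _)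
      (abs_re_conj_mul_mul_le _ _ _)).trans (le_of_eq ?_))
    simp only [hg, hh, sub_add_cancel, RCLike.norm_conj]
    ring
  rw [abs_le, hS]
  exact ⟨hasSum_le (fun z => (abs_le.1 (hpt z)).1) h1.neg hQ,
    hasSum_le (fun z => (abs_le.1 (hpt z)).2) hQ h1⟩

/-! ### Cutting a periodic difference operator along a tiling. -/

section Tiling

variable {Γ V ι : Type*}

open Classical in
/-- The weights of the edges which stay within a cell of the tiling `e`. -/
def kept (e : Γ × V ≃ ℤ × ℤ) (o : ι → ℤ × ℤ) (W : ι → ℤ × ℤ → ℂ) (k : ι) (z : ℤ × ℤ) : ℂ :=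
  if (e.symm (z + o k)).1 = (e.symm z).1 then W k z else 0

open Classical in
/-- The weights of the edges between different cells of the tiling `e`. -/
def cut (e : Γ × V ≃ ℤ × ℤ) (o : ι → ℤ × ℤ) (W : ι → ℤ × ℤ → ℂ) (k : ι) (z : ℤ × ℤ) : ℂ :=
  if (e.symm (z + o k)).1 = (e.symm z).1 then 0 else W k z

theorem kept_add_cut (e : Γ × V ≃ ℤ × ℤ) (o : ι → ℤ × ℤ) (W : ι → ℤ × ℤ → ℂ) (k : ι)
    (z : ℤ × ℤ) : kept e o W k z + cut e o W k z = W k z := by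
  rw [kept, cut]
  split_ifs <;> simp

theorem norm_cut_eq_ite (e : Γ × V ≃ ℤ × ℤ) {o : ι → ℤ × ℤ} {W : ι → ℤ × ℤ → ℂ} {k : ι} {γ : Γ}
    {v : V} {P : Prop} [Decidable P] (h : (e.symm (e (γ, v) + o k)).1 = γ ↔ ¬P) :
    ‖cut e o W k (e (γ, v))‖ = if P then ‖W k (e (γ, v))‖ else 0 := by
  have h' : (e.symm (e (γ, v) + o k)).1 = (e.symm (e (γ, v))).1 ↔ ¬P := by
    rwa [e.symm_apply_apply]
  rw [cut]
  by_cases hP : P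
  · rw [if_pos hP, if_neg (h'.not.2 (not_not.2 hP))]
  · rw [if_neg hP, if_pos (h'.2 hP), norm_zero]

/-- The tiling `e` by the translates of a cell along the homomorphism `τ`. -/
def IsTiling [AddGroup Γ] (e : Γ × V ≃ ℤ × ℤ) (τ : Γ →+ ℤ × ℤ) : Prop := ∀ γ v, e (γ, v) = τ γ + e (0, v)

theorem IsTiling.cell_add [AddGroup Γ] {e : Γ × V ≃ ℤ × ℤ} {τ : Γ →+ ℤ × ℤ} (h : IsTiling e τ) (γ : Γ)
    (z : ℤ × ℤ) : (e.symm (τ γ + z)).1 = γ + (e.symm z).1 := by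
  obtain ⟨⟨γ', v⟩, rfl⟩ := e.surjective z
  rw [h, ← add_assoc, ← map_add, ← h, e.symm_apply_apply, ← h, e.symm_apply_apply]

theorem IsTiling.cut_add [AddGroup Γ] {e : Γ × V ≃ ℤ × ℤ} {τ : Γ →+ ℤ × ℤ} (h : IsTiling e τ) {o : ι → ℤ × ℤ}
    {W : ι → ℤ × ℤ → ℂ} (hW : ∀ k γ z, W k (τ γ + z) = W k z) (k : ι) (γ : Γ) (z : ℤ × ℤ) :
    cut e o W k (τ γ + z) = cut e o W k z := by
  have hcell : (e.symm (τ γ + z + o k)).1 = (e.symm (τ γ + z)).1 ↔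
      (e.symm (z + o k)).1 = (e.symm z).1 := by
    rw [add_assoc, h.cell_add, h.cell_add, add_right_inj]
  rw [cut, cut, hW]
  by_cases hk : (e.symm (z + o k)).1 = (e.symm z).1
  · rw [if_pos hk, if_pos (hcell.2 hk)]
  · rw [if_neg hk, if_neg (hcell.not.2 hk)]

variable [Fintype ι]

theorem band_eq_kept_add_cut (e : Γ × V ≃ ℤ × ℤ) (c : ℤ × ℤ → ℝ) (o : ι → ℤ × ℤ)
    (W : ι → ℤ × ℤ → ℂ) (x : ℤ × ℤ → ℂ) (z : ℤ × ℤ) :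
    band c o W x z = band c o (kept e o W) x z + band 0 o (cut e o W) x z := by
  simp only [band, Pi.zero_apply, Complex.ofReal_zero, zero_mul, zero_add, add_assoc,
    ← Finset.sum_add_distrib]
  congr 1
  refine Finset.sum_congr rfl fun k _ => ?_
  rw [← kept_add_cut e o W k z, ← kept_add_cut e o W k (z - o k), map_add]
  ring

open Classical in
/-- The matrix of the part of a difference operator within the cell `γ`. -/
def cellMatrix (e : Γ × V ≃ ℤ × ℤ) (c : ℤ × ℤ → ℝ) (o : ι → ℤ × ℤ) (W : ι → ℤ × ℤ → ℂ) (γ : Γ) :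
    Matrix V V ℂ := fun v v' =>
  (if e (γ, v') = e (γ, v) then (c (e (γ, v)) : ℂ) else 0)
    + ∑ k, ((if e (γ, v') = e (γ, v) + o k then W k (e (γ, v)) else 0)
      + if e (γ, v) = e (γ, v') + o k then conj (W k (e (γ, v'))) else 0)

theorem isHermitian_cellMatrix (e : Γ × V ≃ ℤ × ℤ) (c : ℤ × ℤ → ℝ) (o : ι → ℤ × ℤ)
    (W : ι → ℤ × ℤ → ℂ) (γ : Γ) : (cellMatrix e c o W γ).IsHermitian := by
  ext v v'
  simp only [Matrix.conjTranspose_apply, cellMatrix, star_add, star_sum]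
  congr 1
  · by_cases h : v = v'
    · subst h; simp
    · simp [h, Ne.symm h]
  · refine Finset.sum_congr rfl fun k _ => ?_
    rw [add_comm]
    congr 1 <;> split_ifs <;> simp

open Classical in
theorem sum_ite_cell [Fintype V] (e : Γ × V ≃ ℤ × ℤ) (γ : Γ) (p : ℤ × ℤ) (F : ℤ × ℤ → ℂ) :
    ∑ v, (if e (γ, v) = p then F (e (γ, v)) else 0) = if (e.symm p).1 = γ then F p else 0 := by
  obtain ⟨⟨γ', w⟩, rfl⟩ := e.surjective p
  by_cases h : γ' = γ
  · subst h
    rw [Finset.sum_eq_single w] <;> simp +contextual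
  · simp [h, Ne.symm h]

/-- Both indices of the matrix are sites of γ, so the full weights W may be used in it: in the sum
over v' an edge survives exactly when its other end lies in γ, which is the condition in `kept`. -/
theorem cellMatrix_mulVec [Fintype V] (e : Γ × V ≃ ℤ × ℤ) (c : ℤ × ℤ → ℝ) (o : ι → ℤ × ℤ)
    (W : ι → ℤ × ℤ → ℂ) (γ : Γ) (x : ℤ × ℤ → ℂ) (v : V) :
    (cellMatrix e c o W γ).mulVec (fun v' => x (e (γ, v'))) v
      = band c o (kept e o W) x (e (γ, v)) := by
  classical
  set z := e (γ, v) with hz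
  have hzγ : (e.symm z).1 = γ := by simp [hz]
  have h : ∀ v', cellMatrix e c o W γ v v' * x (e (γ, v'))
      = (if e (γ, v') = z then (fun p => (c z : ℂ) * x p) (e (γ, v')) else 0)
        + ∑ k, ((if e (γ, v') = z + o k then (fun p => W k z * x p) (e (γ, v')) else 0)
          + if e (γ, v') = z - o k then (fun p => conj (W k p) * x p) (e (γ, v')) else 0) := by
    intro v'
    simp only [cellMatrix, add_mul, Finset.sum_mul, ite_mul, zero_mul, ← hz,
      eq_sub_iff_add_eq, eq_comm (a := z)]
  simp only [Matrix.mulVec, dotProduct]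
  rw [Finset.sum_congr rfl fun v' _ => h v', Finset.sum_add_distrib, Finset.sum_comm]
  simp only [Finset.sum_add_distrib]
  have a₁ := sum_ite_cell e γ z fun p => (c z : ℂ) * x p
  have a₂ := fun k => sum_ite_cell e γ (z + o k) fun p => W k z * x p
  have a₃ := fun k => sum_ite_cell e γ (z - o k) fun p => conj (W k p) * x p
  simp only [a₁, a₂, a₃, band, kept, hzγ, if_true, sub_add_cancel, ite_mul, zero_mul,
    Finset.sum_add_distrib, apply_ite conj, map_zero, eq_comm (a := γ)]

/-- The total weight, at the site `z`, of the edges which leave the cell of `z`. -/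
def cutDegree (e : Γ × V ≃ ℤ × ℤ) (o : ι → ℤ × ℤ) (W : ι → ℤ × ℤ → ℂ) (z : ℤ × ℤ) : ℝ :=
  ∑ k, (‖cut e o W k z‖ + ‖cut e o W k (z - o k)‖)

theorem cutDegree_nonneg (e : Γ × V ≃ ℤ × ℤ) (o : ι → ℤ × ℤ) (W : ι → ℤ × ℤ → ℂ) (z : ℤ × ℤ) :
    0 ≤ cutDegree e o W z := Finset.sum_nonneg fun _ _ => by positivity

variable [AddGroup Γ]

theorem IsTiling.cellMatrix_eq {e : Γ × V ≃ ℤ × ℤ} {τ : Γ →+ ℤ × ℤ} (h : IsTiling e τ)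
    {c : ℤ × ℤ → ℝ} (hc : ∀ γ z, c (τ γ + z) = c z) {o : ι → ℤ × ℤ}
    {W : ι → ℤ × ℤ → ℂ} (hW : ∀ k γ z, W k (τ γ + z) = W k z) (γ : Γ) :
    cellMatrix e c o W γ = cellMatrix e c o W 0 := by
  ext v v'
  simp only [cellMatrix, h γ, hc, hW, add_assoc, add_right_inj]

theorem IsTiling.cutDegree_eq {e : Γ × V ≃ ℤ × ℤ} {τ : Γ →+ ℤ × ℤ} (h : IsTiling e τ)
    {o : ι → ℤ × ℤ} {W : ι → ℤ × ℤ → ℂ} (hW : ∀ k γ z, W k (τ γ + z) = W k z) (γ : Γ) (v : V) :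
    cutDegree e o W (e (γ, v)) = cutDegree e o W (e (0, v)) := by
  simp only [cutDegree, h γ, add_sub_assoc, h.cut_add hW]

/-- The cell of 0 meets every orbit of the translations τ exactly once, and so does its translate by
-s. Reducing back to the cell of 0 therefore permutes the sites. -/
theorem IsTiling.sum_sub [Fintype V] {e : Γ × V ≃ ℤ × ℤ} {τ : Γ →+ ℤ × ℤ} (h : IsTiling e τ)
    {F : ℤ × ℤ → ℝ} (hF : ∀ γ z, F (τ γ + z) = F z) (s : ℤ × ℤ) :
    ∑ v, F (e (0, v) - s) = ∑ v, F (e (0, v)) := by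
  have hinj : Function.Injective fun v => (e.symm (e (0, v) - s)).2 := by
    intro v v' hvv
    obtain ⟨⟨γ, w⟩, hw⟩ := e.surjective (e (0, v) - s)
    obtain ⟨⟨γ', w'⟩, hw'⟩ := e.surjective (e (0, v') - s)
    simp only [← hw, ← hw', e.symm_apply_apply] at hvv
    subst hvv
    rw [h] at hw hw'
    have : e (0, v) = e (γ - γ', v') := by
      rw [h (γ - γ'), map_sub]
      linear_combination hw' - hw
    simpa using congrArg Prod.snd (e.injective this)
  refine Fintype.sum_bijective _ (Finite.injective_iff_bijective.1 hinj) _ _ fun v => ?_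
  obtain ⟨⟨γ, w⟩, hw⟩ := e.surjective (e (0, v) - s)
  rw [← hw, e.symm_apply_apply, h, hF]

/-- Each cut edge is counted once at its starting point and once at its end point; by
`IsTiling.sum_sub` the two counts agree. -/
theorem IsTiling.sum_cutDegree [Fintype V] {e : Γ × V ≃ ℤ × ℤ} {τ : Γ →+ ℤ × ℤ}
    (h : IsTiling e τ) {o : ι → ℤ × ℤ} {W : ι → ℤ × ℤ → ℂ}
    (hW : ∀ k γ z, W k (τ γ + z) = W k z) :
    ∑ v, cutDegree e o W (e (0, v)) = 2 * ∑ k, ∑ v, ‖cut e o W k (e (0, v))‖ := by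
  simp only [cutDegree]
  rw [Finset.sum_comm, Finset.mul_sum]
  refine Finset.sum_congr rfl fun k _ => ?_
  rw [Finset.sum_add_distrib, h.sum_sub (F := fun z => ‖cut e o W k z‖)
    (fun γ z => by rw [h.cut_add hW]), two_mul]

open Classical in
/-- The spectrum of a symmetric difference operator whose coefficients are invariant under the
translations of a tiling has measure at most twice the total cut degree of a cell. -/
theorem volume_spectrum_le_of_tiling [Fintype V] {e : Γ × V ≃ ℤ × ℤ} {τ : Γ →+ ℤ × ℤ} (he : IsTiling e τ)
    {c : ℤ × ℤ → ℝ} (hc : ∀ γ z, c (τ γ + z) = c z) {o : ι → ℤ × ℤ} {W : ι → ℤ × ℤ → ℂ}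
    (hW : ∀ k γ z, W k (τ γ + z) = W k z) {C : ℝ} (hC : ∀ k z, ‖W k z‖ ≤ C)
    {T : ℓ²(ℤ, ℓ²(ℤ, ℂ)) →L[ℂ] ℓ²(ℤ, ℓ²(ℤ, ℂ))} (hTs : ∀ u w, ⟪T u, w⟫_ℂ = ⟪u, T w⟫_ℂ)
    (hT : ∀ u z, T u z.1 z.2 = band c o W (fun p : ℤ × ℤ => u p.1 p.2) z) :
    MeasureTheory.volume {x : ℝ | (x : ℂ) ∈ spectrum ℂ T} ≤
      ENNReal.ofReal (2 * ∑ v, cutDegree e o W (e (0, v))) := by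
  set E : Matrix V V ℂ := Matrix.diagonal fun v => (cutDegree e o W (e (0, v)) : ℂ) with hE
  set M := cellMatrix e c o W 0 with hM
  set Φ := Matrix.toEuclideanCLM (n := V) (𝕜 := ℂ) with hΦ
  have hEs : IsSelfAdjoint E := by
    rw [hE, ← Matrix.isHermitian_iff_isSelfAdjoint, Matrix.isHermitian_diagonal_iff]
    exact fun v => Complex.conj_ofReal _
  have hMs : IsSelfAdjoint M := isHermitian_cellMatrix e c o W 0
  set T' := (tile e).conjStarAlgEquiv T with hT'
  have hspec : spectrum ℂ T = spectrum ℂ T' :=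
    (AlgEquiv.spectrum_eq (tile e).conjStarAlgEquiv T).symm
  -- This is |T - M| ≤ E in the sense of forms: after subtracting the kept edges only the cut ones
  -- remain.
  have hform : ∀ f, |(⟪f, T' f⟫_ℂ).re - (⟪f, cellwise (Φ M) f⟫_ℂ).re|
      ≤ (⟪f, cellwise (Φ E) f⟫_ℂ).re := by
    intro f
    set u := (tile e).symm f with hu
    set x : ℤ × ℤ → ℂ := fun p => u p.1 p.2 with hx
    have hf : ∀ γ v, f γ v = x (e (γ, v)) := fun γ v => by
      rw [hx, ← (tile e).apply_symm_apply f]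
      exact tile_apply e u γ v
    have hfz : ∀ z, f (e.symm z).1 (e.symm z).2 = x z := fun z => by simp [hf]
    have hfT : (⟪f, T' f⟫_ℂ).re = (⟪u, T u⟫_ℂ).re := by
      rw [hT', LinearIsometryEquiv.conjStarAlgEquiv_apply_apply, ← hu,
        ← (tile e).inner_map_map u, hu, LinearIsometryEquiv.apply_symm_apply]
    have h1 : HasSum (fun z => (conj (x z) * band c o W x z).re) (⟪f, T' f⟫_ℂ).re := by
      rw [hfT]
      simpa only [hT] using hasSum_re_inner_site u (T u)
    have h2 : HasSum (fun z => (conj (x z) * band c o (kept e o W) x z).re)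
        (⟪f, cellwise (Φ M) f⟫_ℂ).re := by
      refine (hasSum_re_inner_cell e f (cellwise (Φ M) f)).congr_fun fun z => ?_
      obtain ⟨⟨γ, v⟩, rfl⟩ := e.surjective z
      rw [hfz, ← cellMatrix_mulVec, he.cellMatrix_eq hc hW, e.symm_apply_apply]
      simp only [← hf]
      rfl
    have h3 : HasSum (fun z => cutDegree e o W z * ‖x z‖ ^ 2) (⟪f, cellwise (Φ E) f⟫_ℂ).re := by
      refine (hasSum_re_inner_cell e f (cellwise (Φ E) f)).congr_fun fun z => ?_
      obtain ⟨⟨γ, v⟩, rfl⟩ := e.surjective z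
      have : cellwise (Φ E) f γ v = (cutDegree e o W (e (0, v)) : ℂ) * f γ v :=
        Matrix.mulVec_diagonal _ _ _
      rw [hfz, e.symm_apply_apply, this, he.cutDegree_eq hW, hf, mul_left_comm,
        Complex.re_ofReal_mul, mul_comm (conj _), Complex.mul_conj, Complex.normSq_eq_norm_sq,
        Complex.ofReal_re]
    have hxs : Summable fun z => ‖x z‖ ^ 2 := by
      refine (hasSum_re_inner_site u u).summable.congr fun z => ?_
      rw [mul_comm, Complex.mul_conj, Complex.normSq_eq_norm_sq, Complex.ofReal_re]
    refine abs_le_of_hasSum_band o (W := cut e o W) (C := C) (fun k z => ?_) hxs ?_ h3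
    · rw [cut]
      split_ifs
      · rw [norm_zero]; exact (norm_nonneg _).trans (hC k z)
      · exact hC k z
    · refine (h1.sub h2).congr_fun fun z => ?_
      rw [band_eq_kept_add_cut e c, mul_add, Complex.add_re, add_sub_cancel_left]
  have hadd : ∀ A B : EuclideanSpace ℂ V →L[ℂ] EuclideanSpace ℂ V,
      ∀ f : ℓ²(Γ, EuclideanSpace ℂ V), cellwise (A + B) f = cellwise A f + cellwise B f :=
    fun A B f => by ext γ; rfl
  have hsubc : ∀ A B : EuclideanSpace ℂ V →L[ℂ] EuclideanSpace ℂ V,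
      ∀ f : ℓ²(Γ, EuclideanSpace ℂ V), cellwise (A - B) f = cellwise A f - cellwise B f :=
    fun A B f => by ext γ; rfl
  have hEpos : ∀ y, 0 ≤ (⟪y, Φ E y⟫_ℂ).re := fun y => by
    have : ∀ v, (Φ E y) v = (cutDegree e o W (e (0, v)) : ℂ) * y v := fun v =>
      Matrix.mulVec_diagonal _ _ _
    rw [PiLp.inner_apply, Complex.re_sum]
    refine Finset.sum_nonneg fun v _ => ?_
    rw [this, ← smul_eq_mul, re_inner_real_smul]
    exact mul_nonneg (cutDegree_nonneg _ _ _ _) (by positivity)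
  have hsym : ∀ {A : Matrix V V ℂ}, IsSelfAdjoint A →
      ((Φ A : EuclideanSpace ℂ V →L[ℂ] EuclideanSpace ℂ V) :
        EuclideanSpace ℂ V →ₗ[ℂ] EuclideanSpace ℂ V).IsSymmetric := fun hA =>
    ContinuousLinearMap.isSelfAdjoint_iff_isSymmetric.1 (hA.map Φ)
  rw [hspec]
  -- The squeeze is applied with A = M - E and B = M + E, so that B - A = 2E.
  refine (volume_spectrum_le_of_cellwise_le (T := T') (fun f g => ?_) (hsym (hMs.sub hEs))
    (hsym (hMs.add hEs)) (fun y => ?_) (fun f => ?_) fun f => ?_).trans (le_of_eq ?_)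
  · rw [hT', LinearIsometryEquiv.conjStarAlgEquiv_apply_apply,
      LinearIsometryEquiv.conjStarAlgEquiv_apply_apply, ← (tile e).symm.inner_map_map,
      LinearIsometryEquiv.symm_apply_apply, hTs, ← (tile e).symm.inner_map_map f,
      LinearIsometryEquiv.symm_apply_apply]
  · rw [map_sub, map_add, _root_.sub_apply, _root_.add_apply, inner_sub_right, inner_add_right,
      Complex.sub_re, Complex.add_re]
    linarith [hEpos y]
  · rw [map_sub, hsubc, inner_sub_right, Complex.sub_re]
    linarith [(abs_le.1 (hform f)).1]
  · rw [map_add, hadd, inner_add_right, Complex.add_re]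
    linarith [(abs_le.1 (hform f)).2]
  · rw [← map_sub, add_sub_sub_cancel, ← two_smul ℂ E, map_smul]
    have : LinearMap.trace ℂ _ ((Φ E : EuclideanSpace ℂ V →L[ℂ] EuclideanSpace ℂ V) :
        EuclideanSpace ℂ V →ₗ[ℂ] EuclideanSpace ℂ V) = Matrix.trace E := by
      rw [hΦ, Matrix.coe_toEuclideanCLM_eq_toEuclideanLin,
        Matrix.toEuclideanLin_eq_toLin_orthonormal, Matrix.trace_toLin_eq]
    rw [ContinuousLinearMap.toLinearMap_smul, map_smul, this, hE, Matrix.trace_diagonal]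
    simp

end Tiling

/-! ### Sums over periods and the tiling of ℤ² by boxes. -/

section Box

/-- Moving the window by one trades g s for g (s + p), which is the same number. -/
theorem sum_range_eq_of_periodic {p : ℕ} {g : ℤ → ℝ} (hg : ∀ x, g (x + p) = g x) (s : ℤ) :
    ∑ i ∈ Finset.range p, g (s + i) = ∑ i ∈ Finset.range p, g (1 + i) := by
  have step : ∀ s : ℤ, ∑ i ∈ Finset.range p, g (s + 1 + i) = ∑ i ∈ Finset.range p, g (s + i) := by
    intro s
    have h := (Finset.sum_range_succ' (fun i : ℕ => g (s + i)) p).symm.trans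
      (Finset.sum_range_succ (fun i : ℕ => g (s + i)) p)
    simp only [Nat.cast_zero, add_zero, hg, add_left_inj] at h
    rw [← h]
    refine Finset.sum_congr rfl fun i _ => ?_
    push_cast
    ring_nf
  induction s using Int.induction_on with
  | zero => rw [← step 0, zero_add]
  | succ i ih => rw [step, ih]
  | pred i ih => rw [← ih, ← step, sub_add_cancel]

theorem sum_fin_eq_sum_Icc {p : ℕ} {g : ℤ → ℝ} (hg : ∀ x, g (x + p) = g x) (s : ℤ) :
    ∑ i : Fin p, g (s + (i : ℕ)) = ∑ j ∈ Finset.Icc (1 : ℤ) p, g j := by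
  rw [Fin.sum_univ_eq_sum_range fun i : ℕ => g (s + i), sum_range_eq_of_periodic hg]
  refine Finset.sum_nbij' (fun i : ℕ => (1 + i : ℤ)) (fun j => (j - 1).toNat) ?_ ?_ ?_ ?_ ?_
  · intro i hi; simp only [Finset.mem_range, Finset.mem_Icc] at hi ⊢; omega
  · intro i hi; simp only [Finset.mem_range, Finset.mem_Icc] at hi ⊢; omega
  · intro i hi; simp
  · intro i hi; simp only [Finset.mem_Icc] at hi; omega
  · intro i hi; rfl

/-- Inclusion–exclusion for a row and a column. The corner term is the source of -8|α_{m,n}| in R.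
-/
theorem sum_ite_or {κ κ' : Type*} [Fintype κ] [Fintype κ'] [DecidableEq κ] [DecidableEq κ']
    (i₀ : κ) (j₀ : κ') (G : κ → κ' → ℝ) :
    ∑ i, ∑ j, (if i = i₀ ∨ j = j₀ then G i j else 0)
      = ∑ j, G i₀ j + ∑ i, G i j₀ - G i₀ j₀ := by
  have h : ∀ i j, (if i = i₀ ∨ j = j₀ then G i j else 0)
      = (if i = i₀ then G i j else 0) + (if j = j₀ then G i j else 0)
        - (if i = i₀ then if j = j₀ then G i j else 0 else 0) := by
    intro i j
    by_cases h : i = i₀ <;> by_cases h' : j = j₀ <;> simp [h, h']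
  simp only [h, Finset.sum_add_distrib, Finset.sum_sub_distrib]
  congr 1
  · congr 1
    · rw [Finset.sum_comm]; simp
    · simp
  · rw [Finset.sum_comm]; simp

/-- The partition of `ℤ` into intervals of length `p`, one of which starts at `s + 1`. -/
def intervalTiling (p : ℕ) [NeZero p] (s : ℤ) : ℤ × Fin p ≃ ℤ :=
  (Int.divModEquiv p).symm.trans (Equiv.addRight (s + 1))

theorem intervalTiling_apply (p : ℕ) [NeZero p] (s k : ℤ) (i : Fin p) :
    intervalTiling p s (k, i) = k * p + (s + 1 + (i : ℕ)) := by
  simp only [intervalTiling, Equiv.trans_apply, Int.divModEquiv_symm_apply, Equiv.coe_addRight]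
  ring

theorem intervalTiling_symm_fst_eq_zero (p : ℕ) [NeZero p] (s x : ℤ) :
    ((intervalTiling p s).symm x).1 = 0 ↔ s + 1 ≤ x ∧ x < s + 1 + p := by
  obtain ⟨⟨k, i⟩, rfl⟩ := (intervalTiling p s).surjective x
  rw [Equiv.symm_apply_apply, intervalTiling_apply]
  have hi := i.isLt
  constructor
  · rintro rfl; omega
  · rintro ⟨h₁, h₂⟩
    by_contra hk
    rcases lt_or_gt_of_ne hk with h | h
    · nlinarith
    · nlinarith

/-- The partition of `ℤ²` into boxes of size `p₁ × p₂`, one of which has the corner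
`(m + 1, n + 1)`. -/
def boxTiling (p₁ p₂ : ℕ) [NeZero p₁] [NeZero p₂] (m n : ℤ) :
    (ℤ × ℤ) × (Fin p₁ × Fin p₂) ≃ ℤ × ℤ :=
  (Equiv.prodProdProdComm _ _ _ _).trans
    (Equiv.prodCongr (intervalTiling p₁ m) (intervalTiling p₂ n))

theorem boxTiling_apply (p₁ p₂ : ℕ) [NeZero p₁] [NeZero p₂] (m n : ℤ) (γ : ℤ × ℤ)
    (v : Fin p₁ × Fin p₂) : boxTiling p₁ p₂ m n (γ, v)
      = (γ.1 * p₁ + (m + 1 + (v.1 : ℕ)), γ.2 * p₂ + (n + 1 + (v.2 : ℕ))) := by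
  rw [← intervalTiling_apply, ← intervalTiling_apply]
  rfl

theorem boxTiling_zero (p₁ p₂ : ℕ) [NeZero p₁] [NeZero p₂] (m n : ℤ)
    (v : Fin p₁ × Fin p₂) : boxTiling p₁ p₂ m n (0, v)
      = (m + 1 + (v.1 : ℕ), n + 1 + (v.2 : ℕ)) := by
  simp [boxTiling_apply]

theorem boxTiling_symm_fst_eq_zero (p₁ p₂ : ℕ) [NeZero p₁] [NeZero p₂] (m n : ℤ) (z : ℤ × ℤ) :
    ((boxTiling p₁ p₂ m n).symm z).1 = 0 ↔
      (m + 1 ≤ z.1 ∧ z.1 < m + 1 + p₁) ∧ n + 1 ≤ z.2 ∧ z.2 < n + 1 + p₂ := by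
  rw [← intervalTiling_symm_fst_eq_zero, ← intervalTiling_symm_fst_eq_zero, Prod.ext_iff]
  rfl

/-- The translations of the box tiling. -/
def boxTranslation (p₁ p₂ : ℕ) : ℤ × ℤ →+ ℤ × ℤ :=
  AddMonoidHom.prodMap (AddMonoidHom.mulRight (p₁ : ℤ)) (AddMonoidHom.mulRight (p₂ : ℤ))

theorem isTiling_boxTiling (p₁ p₂ : ℕ) [NeZero p₁] [NeZero p₂] (m n : ℤ) :
    IsTiling (boxTiling p₁ p₂ m n) (boxTranslation p₁ p₂) := by
  intro γ v
  rw [boxTiling_apply, boxTiling_zero]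
  rfl

theorem IsPeriodic.translate {E : Type*} {p₁ p₂ : ℕ} {w : ℤ → ℤ → E} (h : IsPeriodic p₁ p₂ w)
    (γ z : ℤ × ℤ) :
    w (boxTranslation p₁ p₂ γ + z).1 (boxTranslation p₁ p₂ γ + z).2 = w z.1 z.2 := by
  rw [add_comm]
  exact h z.1 z.2 γ.1 γ.2

end Box

/-! ### Counting the cut edges of a Jacobi-block-Jacobi operator. -/

section Main

/-- The directions of the edges coupled by a Jacobi-block-Jacobi operator, one of each pair. -/
def edgeStep : Fin 4 → ℤ × ℤ := ![(0, 1), (1, 0), (1, 1), (1, -1)]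

/-- The weights of the edges of a Jacobi-block-Jacobi operator. -/
def edgeWeight (a : ℤ → ℤ → ℝ) (α b : ℤ → ℤ → ℂ) : Fin 4 → ℤ × ℤ → ℂ :=
  ![fun z => b z.1 z.2, fun z => a z.1 z.2, fun z => α z.1 z.2, fun z => conj (α z.1 (z.2 - 1))]

variable {p₁ p₂ : ℕ} {a c : ℤ → ℤ → ℝ} {α b : ℤ → ℤ → ℂ}

theorem jacobiBlockJacobi_eq_band (h₁ : 0 < p₁) (h₂ : 0 < p₂) (ha : IsPeriodic p₁ p₂ a)
    (hα : IsPeriodic p₁ p₂ α) (hc : IsPeriodic p₁ p₂ c) (hb : IsPeriodic p₁ p₂ b)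
    (u : ℓ²(ℤ, ℓ²(ℤ, ℂ))) (z : ℤ × ℤ) :
    jacobiBlockJacobi a α c b u z.1 z.2
      = band (fun p : ℤ × ℤ => c p.1 p.2) edgeStep (edgeWeight a α b)
        (fun p : ℤ × ℤ => u p.1 p.2) z := by
  obtain ⟨q, r⟩ := z
  rw [jacobiBlockJacobi_apply h₁ h₂ ha hα hc hb]
  simp only [lp.coeFn_add, Pi.add_apply, jacobi_apply_of_isPeriodic h₁ h₂ ha hα,
    jacobi_apply_of_isPeriodic h₁ h₂ hc hb]
  simp [band, Fin.sum_univ_four, edgeStep, edgeWeight, ← sub_eq_add_neg]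
  ring

theorem edgeWeight_translate (ha : IsPeriodic p₁ p₂ a) (hα : IsPeriodic p₁ p₂ α)
    (hb : IsPeriodic p₁ p₂ b) (k : Fin 4) (γ z : ℤ × ℤ) :
    edgeWeight a α b k (boxTranslation p₁ p₂ γ + z) = edgeWeight a α b k z := by
  fin_cases k
  · exact hb.translate γ z
  · exact congrArg Complex.ofReal (ha.translate γ z)
  · exact hα.translate γ z
  · refine congrArg conj ?_
    rw [← hα.translate γ (z.1, z.2 - 1)]
    simp only [Prod.fst_add, Prod.snd_add, add_sub_assoc]

theorem exists_norm_edgeWeight_le (h₁ : 0 < p₁) (h₂ : 0 < p₂) (ha : IsPeriodic p₁ p₂ a)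
    (hα : IsPeriodic p₁ p₂ α) (hb : IsPeriodic p₁ p₂ b) :
    ∃ C, ∀ k z, ‖edgeWeight a α b k z‖ ≤ C := by
  obtain ⟨A, -, hA⟩ := ha.bounded h₁ h₂
  obtain ⟨K, -, hK⟩ := hα.bounded h₁ h₂
  obtain ⟨B, -, hB⟩ := hb.bounded h₁ h₂
  refine ⟨max A (max K B), fun k z => ?_⟩
  fin_cases k
  · exact (hB z.1 z.2).trans (by simp)
  · exact ((Complex.norm_real _).trans_le (hA z.1 z.2)).trans (by simp)
  · exact (hK z.1 z.2).trans (by simp)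
  · exact ((RCLike.norm_conj _).trans_le (hK z.1 (z.2 - 1))).trans (by simp)

theorem sum_norm_cut_edgeWeight [NeZero p₁] [NeZero p₂] (ha : IsPeriodic p₁ p₂ a)
    (hα : IsPeriodic p₁ p₂ α) (hb : IsPeriodic p₁ p₂ b) (m n : ℤ) :
    4 * ∑ k, ∑ v, ‖cut (boxTiling p₁ p₂ m n) edgeStep (edgeWeight a α b) k
      (boxTiling p₁ p₂ m n (0, v))‖ = R p₁ p₂ a α b m n := by
  have hp₁ := NeZero.pos p₁
  have hp₂ := NeZero.pos p₂
  -- Edges leave the box through its last column i₀, its last row j₀ or, for the step (1, -1), its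
  -- first row j₁.
  set i₀ : Fin p₁ := ⟨p₁ - 1, by omega⟩ with hi₀
  set j₀ : Fin p₂ := ⟨p₂ - 1, by omega⟩ with hj₀
  set j₁ : Fin p₂ := ⟨0, by omega⟩ with hj₁
  -- The box starts at (m + 1, n + 1) so that its last column and last row are congruent to m and n.
  have hi₀' : m + 1 + ((i₀ : ℕ) : ℤ) = m + 1 * p₁ := by simp only [hi₀]; omega
  have hj₀' : n + 1 + ((j₀ : ℕ) : ℤ) = n + 1 * p₂ := by simp only [hj₀]; omega
  have hj₁' : n + 1 + ((j₁ : ℕ) : ℤ) - 1 = n := by simp [hj₁]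
  have perFst : ∀ {E : Type} {w : ℤ → ℤ → E}, IsPeriodic p₁ p₂ w → ∀ q r,
      w (q + 1 * p₁) r = w q r := fun hw q r => by simpa using hw q r 1 0
  have perSnd : ∀ {E : Type} {w : ℤ → ℤ → E}, IsPeriodic p₁ p₂ w → ∀ q r,
      w q (r + 1 * p₂) = w q r := fun hw q r => by simpa using hw q r 0 1
  have sumFst : ∀ {w : ℤ → ℤ → ℂ}, IsPeriodic p₁ p₂ w → ∀ s r,
      ∑ i : Fin p₁, ‖w (s + (i : ℕ)) r‖ = ∑ j ∈ Finset.Icc (1 : ℤ) p₁, ‖w j r‖ := fun {w} hw s r =>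
    sum_fin_eq_sum_Icc (g := fun x => ‖w x r‖) (fun x => by simpa using congrArg norm (perFst hw x r)) s
  have sumSnd : ∀ {w : ℤ → ℤ → ℂ}, IsPeriodic p₁ p₂ w → ∀ s q,
      ∑ i : Fin p₂, ‖w q (s + (i : ℕ))‖ = ∑ j ∈ Finset.Icc (1 : ℤ) p₂, ‖w q j‖ := fun {w} hw s q =>
    sum_fin_eq_sum_Icc (g := fun x => ‖w q x‖) (fun x => by simpa using congrArg norm (perSnd hw q x)) s
  have ha' : IsPeriodic p₁ p₂ fun q r => (a q r : ℂ) := fun q r k l =>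
    congrArg Complex.ofReal (ha q r k l)
  have e0 : ∑ v, ‖cut (boxTiling p₁ p₂ m n) edgeStep (edgeWeight a α b) 0
      (boxTiling p₁ p₂ m n (0, v))‖ = ∑ j ∈ Finset.Icc (1 : ℤ) p₁, ‖b j n‖ := by
    have : ∀ v, ‖cut (boxTiling p₁ p₂ m n) edgeStep (edgeWeight a α b) 0
        (boxTiling p₁ p₂ m n (0, v))‖
          = if v.2 = j₀ then ‖b (m + 1 + (v.1 : ℕ)) (n + 1 + (v.2 : ℕ))‖ else 0 := by
      rintro ⟨i, j⟩
      have h : ((boxTiling p₁ p₂ m n).symm (boxTiling p₁ p₂ m n (0, (i, j)) + edgeStep 0)).1 = 0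
          ↔ ¬ j = j₀ := by
        rw [boxTiling_symm_fst_eq_zero, boxTiling_zero, Fin.ext_iff]
        simp only [edgeStep, Matrix.cons_val, Prod.mk_add_mk, hj₀]
        omega
      rw [norm_cut_eq_ite _ h]
      simp only [boxTiling_zero, edgeWeight, Matrix.cons_val]
    simp only [this]
    rw [Fintype.sum_prod_type]
    simp only [Finset.sum_ite_eq', Finset.mem_univ, if_true, hj₀', perSnd hb, sumFst hb]
  have e1 : ∑ v, ‖cut (boxTiling p₁ p₂ m n) edgeStep (edgeWeight a α b) 1
      (boxTiling p₁ p₂ m n (0, v))‖ = ∑ k ∈ Finset.Icc (1 : ℤ) p₂, |a m k| := by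
    have : ∀ v, ‖cut (boxTiling p₁ p₂ m n) edgeStep (edgeWeight a α b) 1
        (boxTiling p₁ p₂ m n (0, v))‖
          = if v.1 = i₀ then ‖(a (m + 1 + (v.1 : ℕ)) (n + 1 + (v.2 : ℕ)) : ℂ)‖ else 0 := by
      rintro ⟨i, j⟩
      have h : ((boxTiling p₁ p₂ m n).symm (boxTiling p₁ p₂ m n (0, (i, j)) + edgeStep 1)).1 = 0
          ↔ ¬ i = i₀ := by
        rw [boxTiling_symm_fst_eq_zero, boxTiling_zero, Fin.ext_iff]
        simp only [edgeStep, Matrix.cons_val, Prod.mk_add_mk, hi₀]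
        omega
      rw [norm_cut_eq_ite _ h]
      simp only [boxTiling_zero, edgeWeight, Matrix.cons_val]
    simp only [this]
    rw [Fintype.sum_prod_type_right]
    simp only [Finset.sum_ite_eq', Finset.mem_univ, if_true, hi₀', perFst ha, sumSnd ha']
    simp only [Complex.norm_real, Real.norm_eq_abs]
  have e2 : ∑ v, ‖cut (boxTiling p₁ p₂ m n) edgeStep (edgeWeight a α b) 2
      (boxTiling p₁ p₂ m n (0, v))‖ = ∑ k ∈ Finset.Icc (1 : ℤ) p₂, ‖α m k‖
        + ∑ j ∈ Finset.Icc (1 : ℤ) p₁, ‖α j n‖ - ‖α m n‖ := by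
    have : ∀ v, ‖cut (boxTiling p₁ p₂ m n) edgeStep (edgeWeight a α b) 2
        (boxTiling p₁ p₂ m n (0, v))‖
          = if v.1 = i₀ ∨ v.2 = j₀ then ‖α (m + 1 + (v.1 : ℕ)) (n + 1 + (v.2 : ℕ))‖ else 0 := by
      rintro ⟨i, j⟩
      have h : ((boxTiling p₁ p₂ m n).symm (boxTiling p₁ p₂ m n (0, (i, j)) + edgeStep 2)).1 = 0
          ↔ ¬ (i = i₀ ∨ j = j₀) := by
        rw [boxTiling_symm_fst_eq_zero, boxTiling_zero, Fin.ext_iff, Fin.ext_iff]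
        simp only [edgeStep, Matrix.cons_val, Prod.mk_add_mk, hi₀, hj₀]
        omega
      rw [norm_cut_eq_ite _ h]
      simp only [boxTiling_zero, edgeWeight, Matrix.cons_val]
    simp only [this]
    rw [Fintype.sum_prod_type, sum_ite_or i₀ j₀
      fun (i : Fin p₁) (j : Fin p₂) => ‖α (m + 1 + (i : ℕ)) (n + 1 + (j : ℕ))‖]
    simp only [hi₀', hj₀', perFst hα, perSnd hα, sumFst hα, sumSnd hα]
  -- An edge in direction (1, -1) from (q, r) has weight conj α_{q,r-1}. From the first row r = n +
  -- 1 this is again an entry of row n, so the count is the same as for direction (1, 1).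
  have e3 : ∑ v, ‖cut (boxTiling p₁ p₂ m n) edgeStep (edgeWeight a α b) 3
      (boxTiling p₁ p₂ m n (0, v))‖ = ∑ k ∈ Finset.Icc (1 : ℤ) p₂, ‖α m k‖
        + ∑ j ∈ Finset.Icc (1 : ℤ) p₁, ‖α j n‖ - ‖α m n‖ := by
    have : ∀ v, ‖cut (boxTiling p₁ p₂ m n) edgeStep (edgeWeight a α b) 3
        (boxTiling p₁ p₂ m n (0, v))‖
          = if v.1 = i₀ ∨ v.2 = j₁ then ‖α (m + 1 + (v.1 : ℕ)) (n + (v.2 : ℕ))‖ else 0 := by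
      rintro ⟨i, j⟩
      have h : ((boxTiling p₁ p₂ m n).symm (boxTiling p₁ p₂ m n (0, (i, j)) + edgeStep 3)).1 = 0
          ↔ ¬ (i = i₀ ∨ j = j₁) := by
        rw [boxTiling_symm_fst_eq_zero, boxTiling_zero, Fin.ext_iff, Fin.ext_iff]
        simp only [edgeStep, Matrix.cons_val, Prod.mk_add_mk, hi₀, hj₁]
        omega
      have h' : n + 1 + ((j : ℕ) : ℤ) - 1 = n + (j : ℕ) := by ring
      rw [norm_cut_eq_ite _ h]
      simp only [boxTiling_zero, edgeWeight, Matrix.cons_val, h', RCLike.norm_conj]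
    have hj₁'' : n + ((j₁ : ℕ) : ℤ) = n := by simp [hj₁]
    simp only [this]
    rw [Fintype.sum_prod_type, sum_ite_or i₀ j₁
      fun (i : Fin p₁) (j : Fin p₂) => ‖α (m + 1 + (i : ℕ)) (n + (j : ℕ))‖]
    simp only [hi₀', hj₁'', perFst hα, sumFst hα, sumSnd hα]
  rw [Fin.sum_univ_four, e0, e1, e2, e3, R]
  simp only [Finset.sum_add_distrib, ← Finset.mul_sum]
  ring

theorem R_add_mul (ha : IsPeriodic p₁ p₂ a) (hα : IsPeriodic p₁ p₂ α) (hb : IsPeriodic p₁ p₂ b)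
    (m n k l : ℤ) : R p₁ p₂ a α b (m + k * p₁) (n + l * p₂) = R p₁ p₂ a α b m n := by
  have hFst : ∀ {E : Type} {w : ℤ → ℤ → E}, IsPeriodic p₁ p₂ w → ∀ q r,
      w (q + k * p₁) r = w q r := fun hw q r => by simpa using hw q r k 0
  have hSnd : ∀ {E : Type} {w : ℤ → ℤ → E}, IsPeriodic p₁ p₂ w → ∀ q r,
      w q (r + l * p₂) = w q r := fun hw q r => by simpa using hw q r 0 l
  simp only [R, hFst ha, hFst hα, hSnd hα, hSnd hb]

theorem finite_range_R (h₁ : 0 < p₁) (h₂ : 0 < p₂) (ha : IsPeriodic p₁ p₂ a)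
    (hα : IsPeriodic p₁ p₂ α) (hb : IsPeriodic p₁ p₂ b) :
    (Set.range fun mn : ℤ × ℤ => R p₁ p₂ a α b mn.1 mn.2).Finite := by
  refine (((Set.finite_Ico (0 : ℤ) p₁).prod (Set.finite_Ico (0 : ℤ) p₂)).image
    fun mn : ℤ × ℤ => R p₁ p₂ a α b mn.1 mn.2).subset ?_
  rintro _ ⟨⟨m, n⟩, rfl⟩
  refine ⟨(m % p₁, n % p₂), ⟨⟨Int.emod_nonneg _ (by omega), Int.emod_lt_of_pos _ (by omega)⟩,
    Int.emod_nonneg _ (by omega), Int.emod_lt_of_pos _ (by omega)⟩, ?_⟩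
  change R p₁ p₂ a α b (m % p₁) (n % p₂) = R p₁ p₂ a α b m n
  rw [← R_add_mul ha hα hb _ _ (m / p₁) (n / p₂), Int.emod_add_ediv_mul, Int.emod_add_ediv_mul]

theorem volume_spectrum_jacobiBlockJacobi_le (h₁ : 0 < p₁) (h₂ : 0 < p₂)
    (ha : IsPeriodic p₁ p₂ a) (hα : IsPeriodic p₁ p₂ α) (hc : IsPeriodic p₁ p₂ c)
    (hb : IsPeriodic p₁ p₂ b) (m n : ℤ) :
    MeasureTheory.volume {x : ℝ | (x : ℂ) ∈ spectrum ℂ (jacobiBlockJacobi a α c b)}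
      ≤ ENNReal.ofReal (R p₁ p₂ a α b m n) := by
  have : NeZero p₁ := ⟨h₁.ne'⟩
  have : NeZero p₂ := ⟨h₂.ne'⟩
  obtain ⟨C, hC⟩ := exists_norm_edgeWeight_le h₁ h₂ ha hα hb
  refine (volume_spectrum_le_of_tiling (isTiling_boxTiling p₁ p₂ m n)
    (fun γ z => hc.translate γ z) (edgeWeight_translate ha hα hb) hC
    (ContinuousLinearMap.isSelfAdjoint_iff_isSymmetric.1
      (isSelfAdjoint_jacobiBlockJacobi h₁ h₂ ha hα hc hb))
    (jacobiBlockJacobi_eq_band h₁ h₂ ha hα hc hb)).trans (le_of_eq ?_)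
  rw [(isTiling_boxTiling p₁ p₂ m n).sum_cutDegree (edgeWeight_translate ha hα hb),
    ← sum_norm_cut_edgeWeight ha hα hb]
  congr 1
  ring

end Main

end JBJ

end

theorem theorem1p1 (p₁ p₂ : ℕ) (hp₁ : 3 ≤ p₁) (hp₂ : 3 ≤ p₂)
    (a c : ℤ → ℤ → ℝ) (α b : ℤ → ℤ → ℂ)
    (ha : JBJ.IsPeriodic p₁ p₂ a) (hα : JBJ.IsPeriodic p₁ p₂ α)
    (hc : JBJ.IsPeriodic p₁ p₂ c) (hb : JBJ.IsPeriodic p₁ p₂ b) :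
    ∃ R₀ : ℝ, IsLeast (Set.range fun mn : ℤ × ℤ => JBJ.R p₁ p₂ a α b mn.1 mn.2) R₀ ∧
      MeasureTheory.volume {x : ℝ | (x : ℂ) ∈ spectrum ℂ (JBJ.jacobiBlockJacobi a α c b)}
        ≤ ENNReal.ofReal R₀ := by
  obtain ⟨R₀, ⟨⟨m, n⟩, rfl⟩, hmin⟩ := Set.exists_min_image _ id
    (JBJ.finite_range_R (by omega) (by omega) ha hα hb) (Set.range_nonempty _)
  exact ⟨_, ⟨⟨(m, n), rfl⟩, hmin⟩,
    JBJ.volume_spectrum_jacobiBlockJacobi_le (by omega) (by omega) ha hα hc hb m n⟩
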